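/- Fix $k\in\{0,1,2,\dots\}$, $\alpha>k+1/2$ and $\sigma>0$. Let $\psi_1(x)=1$, $\psi_{2m}(x)=\sqrt2\cos(2\pi m x)$, $\psi_{2m+1}(x)=\sqrt2\sin(2\pi m x)$ ($m\ge 1$) be the Fourier basis of $L^2[0,1]$ and let $$H^\alpha[0,1]=\Big\{f\in L^2[0,1]:\ \sum_{i=1}^\infty i^\alpha|f_i|<\infty\Big\},\qquad f_i=\int_0^1 f\psi_i .$$ Let $f_0\in H^\alpha[0,1]\cap C^k[0,1]$, and let $(X_1,Y_1),\dots,(X_n,Y_n)$ be independent with $X_i$ uniform on $[0,1]$ and $Y_i=f_0(X_i)+\varepsilon_i$, where $\varepsilon_i\sim N(0,\sigma^2)$ is independent of $X_i$. Let $K(x,x')=\sum_{i\ge1}\mu_i\psi_i(x)\psi_i(x')$ on $[0,1]^2$ with $c_1 i^{-2\alpha}\le\mu_i\le c_2 i^{-2\alpha}$ for all $i\ge 1$, where $0<c_1\le c_2$, and let $$\hat f_n(x)=K(x,X)\,[K(X,X)+n\lambda I_n]^{-1}\,Y,\qquad x\in[0,1],$$ be the posterior mean under the Gaussian process prior $\mathrm{GP}(0,\sigma^2(n\lambda)^{-1}K)$.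 Let $0<d_1\le d_2$ and $R\ge 0$. Then there is a constant $C>0$, depending only on $\alpha,k,\sigma,c_1,c_2,d_1,d_2,R$, such that whenever $\sum_i i^\alpha|f_{0,i}|\le R$, $n\ge2$ and $$d_1\Big(\frac{\log n}{n}\Big)^{\frac{2\alpha}{2\alpha+1}}\le\lambda\le d_2\Big(\frac{\log n}{n}\Big)^{\frac{2\alpha}{2\alpha+1}},$$ with probability at least $1-n^{-10}$ the function $\hat f_n$ is $k$ times continuously differentiable on $[0,1]$ and $$\|\hat f_n^{(k)}-f_0^{(k)}\|_{L^2[0,1]}\le C\Big(\frac{\log n}{n}\Big)^{\frac{\alpha-k}{2\alpha+1}} .$$ -/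

import Mathlib

open MeasureTheory ProbabilityTheory Set
open scoped NNReal ENNReal Matrix

noncomputable section

/-- The uniform law on `[0,1]`, the distribution of the covariate. -/
def unifLaw : Measure ℝ := volume.restrict (Icc (0 : ℝ) 1)

/-- The Fourier basis of `L²[0,1]`, indexed from `1`: the function number `1` is the constant `1`,
number `2 * m` is `√2 cos (2 π m x)`, number `2 * m + 1` is `√2 sin (2 π m x)`, for `m ≥ 1`.
The index `0` is never used. -/
def trigBasis (i : ℕ) (x : ℝ) : ℝ :=
  if i = 1 then 1
  else if Even i then Real.sqrt 2 * Real.cos (2 * Real.pi * ((i / 2 : ℕ) : ℝ) * x)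
  else Real.sqrt 2 * Real.sin (2 * Real.pi * ((i / 2 : ℕ) : ℝ) * x)

/-- The coefficient `⟨f, ψ_i⟩` in `L²[0,1]`. -/
def trigCoef (f : ℝ → ℝ) (i : ℕ) : ℝ := ∫ x, f x * trigBasis i x ∂unifLaw

/-- The terms `i ^ α * |f_i|`, `i ≥ 1`; the `j`-th term of the sequence belongs to `i = j + 1`. -/
def holderTerm (α : ℝ) (f : ℝ → ℝ) (j : ℕ) : ℝ :=
  ((j + 1 : ℕ) : ℝ) ^ α * |trigCoef f (j + 1)|

/-- The space `H^α[0,1]`: square integrable functions with `∑ i ^ α |f_i| < ∞`. -/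
def holderSpace (α : ℝ) : Set (ℝ → ℝ) :=
  {f | MemLp f 2 unifLaw ∧ Summable (holderTerm α f)}

/-- `K(x,x') = ∑_{i ≥ 1} μ_i ψ_i(x) ψ_i(x')` at all `x, x' ∈ [0,1]`: the kernel `K` has the
eigenvalues `μ_i` and the Fourier basis as eigenfunctions. -/
def HasFourierEigenvalues (K : ℝ → ℝ → ℝ) (μ : ℕ → ℝ) : Prop :=
  ∀ x ∈ Icc (0 : ℝ) 1, ∀ x' ∈ Icc (0 : ℝ) 1,
    HasSum (fun j : ℕ => μ (j + 1) * trigBasis (j + 1) x * trigBasis (j + 1) x') (K x x')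

/-- The law of one observation `(X, Y)`: `X` is uniform on `[0,1]` and `Y = f₀(X) + ε` with
`ε ~ N(0, σ²)` independent of `X`. -/
def obsLaw (f₀ : ℝ → ℝ) (σ : ℝ≥0) : Measure (ℝ × ℝ) :=
  (unifLaw.prod (gaussianReal 0 (σ ^ 2))).map (fun p => (p.1, f₀ p.1 + p.2))

/-- The law of `n` independent observations. -/
def dataLaw (f₀ : ℝ → ℝ) (σ : ℝ≥0) (n : ℕ) : Measure (Fin n → ℝ × ℝ) :=
  Measure.pi (fun _ => obsLaw f₀ σ)

/-- The kernel matrix `K(X, X)`. -/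
def gramMatrix (K : ℝ → ℝ → ℝ) {n : ℕ} (D : Fin n → ℝ × ℝ) : Matrix (Fin n) (Fin n) ℝ :=
  Matrix.of fun i j => K (D i).1 (D j).1

/-- The mean `x ↦ K(x, X) [K(X, X) + n lam I]⁻¹ Y` of the posterior under the prior
`GP(0, σ² (n lam)⁻¹ K)`. -/
def posteriorMean (K : ℝ → ℝ → ℝ) (lam : ℝ) {n : ℕ} (D : Fin n → ℝ × ℝ) (x : ℝ) : ℝ :=
  (fun i => K x (D i).1) ⬝ᵥ
    ((gramMatrix K D + ((n : ℝ) * lam) • (1 : Matrix (Fin n) (Fin n) ℝ))⁻¹ *ᵥ fun i => (D i).2)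

/-- The `k`-th derivative of a function on `[0,1]` (one-sided at the endpoints). -/
def deriv01 (k : ℕ) (f : ℝ → ℝ) (x : ℝ) : ℝ := iteratedDerivWithin k f (Icc (0 : ℝ) 1) x

end

/-! Everything is done on Fourier coefficients. Write `θ` for those of `f₀`, `a` for the ridge
solution, and `h j = μ j * ∑ l, a l * ψ j l - θ j` for those of the estimation error. The series of
`f₀` converges pointwise (`hasSum_trigCoef_mul_trigBasis`), so by the normal equations the error at
the design point `l` is `H l = ε l - n λ a l`. Computing `∑ H l * a l` in two ways gives
`errCoef_energy_identity`: with `Q = ∑ h²/μ`, the quantity `∑ H² + nλQ` equals a noise term minus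
the bias term `nλ ∑ hθ/μ`.

Let `U = ∑ h² (1 + λ/μ)`. On average `∑ H²` is `n ∑ h²`, so the left side should be about `n U`. No
operator concentration is needed to make this rigorous. Scalar tail bounds and a union bound over
all frequencies (`exists_good_event`) control the noise coefficients and the empirical covariances
with deviations weighted by levels `L j` of order `log n + log j`. Since the covariance bound
factorises in `i` and `j`, `abs_sum_sq_sub_le` and Cauchy–Schwarz bound the discrepancy by `√(8n) U
V`, where `V = ∑ μ/(μ+λ) L`. The noise term is at most `√(4σ²n) √(UV)`, and the bias term at most `n
√U √(λ ∑ θ²/μ)`. Hence `errCoef_bound`: `κ² U ≤ 2 (4σ²V/n + λ ∑ θ²/μ)`.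

Polynomial eigenvalue decay makes `V` of order `effDim * log n` (`exists_tsum_weight_mul_level_le`),
so both terms have order `rate`. For `α > 1/2` the relative discrepancy `V √(8/n)` tends to zero;
for the finitely many remaining `n` the penalty alone gives coercivity (`exists_coercivity_const`).

By Parseval, the `k`-th derivative costs a factor `j^(2k)` on `h j ^ 2`. The inequality
`weight_mul_pow_le` absorbs it into `(1 + λ/μ)` at the price `(c/λ)^(k/α)`, and `rate * rate^(-k/α)`
is the square of the claimed rate. -/

instance : IsProbabilityMeasure unifLaw := ⟨by simp [unifLaw]⟩

/-! ### The Fourier basis, its derivatives and their orthogonality. -/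

theorem integral_unifLaw (f : ℝ → ℝ) : ∫ x, f x ∂unifLaw = ∫ x in (0 : ℝ)..1, f x := by
  rw [unifLaw, integral_Icc_eq_integral_Ioc, intervalIntegral.integral_of_le zero_le_one]

theorem ae_mem_Icc_unifLaw : ∀ᵐ x ∂unifLaw, x ∈ Icc (0 : ℝ) 1 :=
  ae_restrict_mem measurableSet_Icc

theorem integral_cos_int (p : ℤ) (φ : ℝ) :
    ∫ x, Real.cos (2 * Real.pi * p * x + φ) ∂unifLaw = if p = 0 then Real.cos φ else 0 := by
  split_ifs with h
  · simp [h]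
  · have hp : 2 * Real.pi * (p : ℝ) ≠ 0 := by
      have : (p : ℝ) ≠ 0 := by exact_mod_cast h
      positivity
    rw [integral_unifLaw,
      intervalIntegral.integral_comp_mul_add (fun x => Real.cos x) hp φ, integral_cos]
    have : 2 * Real.pi * (p : ℝ) * 1 + φ = φ + p * (2 * Real.pi) := by ring
    rw [this, Real.sin_add_int_mul_two_pi]
    simp

/-- The amplitude of `trigBasis i` as a shifted cosine. -/
noncomputable def trigAmp (i : ℕ) : ℝ := if i = 1 then 1 else Real.sqrt 2

/-- The phase of `trigBasis i` as a shifted cosine. -/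
noncomputable def trigPhase (i : ℕ) : ℝ := if i = 1 ∨ Even i then 0 else -(Real.pi / 2)

/-- The `k`-th derivative of `trigBasis i`. -/
noncomputable def trigDeriv (k i : ℕ) (x : ℝ) : ℝ :=
  trigAmp i * (2 * Real.pi * ((i / 2 : ℕ) : ℝ)) ^ k *
    Real.cos (2 * Real.pi * ((i / 2 : ℕ) : ℝ) * x + (trigPhase i + k * (Real.pi / 2)))

theorem trigDeriv_zero (i : ℕ) (x : ℝ) : trigDeriv 0 i x = trigBasis i x := by
  unfold trigDeriv trigBasis trigAmp trigPhase
  by_cases h1 : i = 1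
  · simp [h1]
  · by_cases h2 : Even i
    · simp [h1, h2]
    · simp only [h1, h2, if_false, or_self, pow_zero, mul_one, Nat.cast_zero, zero_mul, add_zero]
      rw [← sub_eq_add_neg, Real.cos_sub_pi_div_two]

theorem hasDerivAt_trigDeriv (k i : ℕ) (x : ℝ) :
    HasDerivAt (trigDeriv k i) (trigDeriv (k + 1) i x) x := by
  unfold trigDeriv
  have h1 : HasDerivAt (fun x : ℝ => 2 * Real.pi * ((i / 2 : ℕ) : ℝ) * x +
      (trigPhase i + k * (Real.pi / 2))) (2 * Real.pi * ((i / 2 : ℕ) : ℝ)) x := by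
    simpa using ((hasDerivAt_id x).const_mul (2 * Real.pi * ((i / 2 : ℕ) : ℝ))).add_const
      (trigPhase i + k * (Real.pi / 2))
  refine ((h1.cos).const_mul (trigAmp i * (2 * Real.pi * ((i / 2 : ℕ) : ℝ)) ^ k)).congr_deriv ?_
  have h2 : 2 * Real.pi * ((i / 2 : ℕ) : ℝ) * x + (trigPhase i + ((k + 1 : ℕ) : ℝ) * (Real.pi / 2))
      = (2 * Real.pi * ((i / 2 : ℕ) : ℝ) * x + (trigPhase i + k * (Real.pi / 2))) + Real.pi / 2 := by
    push_cast; ring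
  rw [h2, Real.cos_add_pi_div_two]
  ring

theorem continuous_trigDeriv (k i : ℕ) : Continuous (trigDeriv k i) := by
  unfold trigDeriv; fun_prop

theorem continuous_trigBasis (i : ℕ) : Continuous (trigBasis i) := by
  simpa [← funext (trigDeriv_zero i)] using continuous_trigDeriv 0 i

theorem trigAmp_nonneg (i : ℕ) : 0 ≤ trigAmp i := by
  unfold trigAmp; split_ifs <;> positivity

theorem trigAmp_le (i : ℕ) : trigAmp i ≤ Real.sqrt 2 := by
  unfold trigAmp; split_ifs
  · exact Real.one_le_sqrt.2 (by norm_num)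
  · exact le_rfl

theorem abs_trigDeriv_le (k i : ℕ) (x : ℝ) :
    |trigDeriv k i x| ≤ Real.sqrt 2 * (Real.pi * i) ^ k := by
  unfold trigDeriv
  have hm : (2 * Real.pi * ((i / 2 : ℕ) : ℝ)) ≤ Real.pi * i := by
    have : ((i / 2 : ℕ) : ℝ) ≤ i / 2 := Nat.cast_div_le
    nlinarith [Real.pi_pos]
  have h0 : 0 ≤ 2 * Real.pi * ((i / 2 : ℕ) : ℝ) := by positivity
  rw [abs_mul, abs_of_nonneg (mul_nonneg (trigAmp_nonneg i) (pow_nonneg h0 k))]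
  calc _ ≤ trigAmp i * (2 * Real.pi * ((i / 2 : ℕ) : ℝ)) ^ k * 1 :=
        mul_le_mul_of_nonneg_left (Real.abs_cos_le_one _)
          (mul_nonneg (trigAmp_nonneg i) (pow_nonneg h0 k))
    _ ≤ _ := by
        rw [mul_one]
        exact mul_le_mul (trigAmp_le i) (pow_le_pow_left₀ h0 hm k) (pow_nonneg h0 k) (by positivity)

theorem abs_trigBasis_le (i : ℕ) (x : ℝ) : |trigBasis i x| ≤ Real.sqrt 2 := by
  simpa [trigDeriv_zero] using abs_trigDeriv_le 0 i x

/-- Differentiation only rescales the amplitude and shifts every phase by the same multiple of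
`π/2`. Product-to-sum formulas then reduce orthogonality to integrals of cosines of integer
frequency. -/
theorem integral_trigDeriv_mul (k : ℕ) {i j : ℕ} (hi : 1 ≤ i) (hj : 1 ≤ j) (hij : i ≠ j) :
    ∫ x, trigDeriv k i x * trigDeriv k j x ∂unifLaw = 0 := by
  have key : ∀ x, trigDeriv k i x * trigDeriv k j x =
      trigAmp i * (2 * Real.pi * ((i / 2 : ℕ) : ℝ)) ^ k *
        (trigAmp j * (2 * Real.pi * ((j / 2 : ℕ) : ℝ)) ^ k) / 2 *
      (Real.cos (2 * Real.pi * (((i / 2 : ℕ) - (j / 2 : ℕ) : ℤ) : ℝ) * x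
          + (trigPhase i - trigPhase j)) +
       Real.cos (2 * Real.pi * (((i / 2 : ℕ) + (j / 2 : ℕ) : ℤ) : ℝ) * x
          + (trigPhase i + trigPhase j + k * Real.pi))) := by
    intro x
    unfold trigDeriv
    have h1 : 2 * Real.pi * (((i / 2 : ℕ) - (j / 2 : ℕ) : ℤ) : ℝ) * x + (trigPhase i - trigPhase j)
      = (2 * Real.pi * ((i / 2 : ℕ) : ℝ) * x + (trigPhase i + k * (Real.pi / 2))) -
        (2 * Real.pi * ((j / 2 : ℕ) : ℝ) * x + (trigPhase j + k * (Real.pi / 2))) := by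
      rw [Int.cast_sub, Int.cast_natCast, Int.cast_natCast]; ring
    have h2 : 2 * Real.pi * (((i / 2 : ℕ) + (j / 2 : ℕ) : ℤ) : ℝ) * x
          + (trigPhase i + trigPhase j + k * Real.pi)
      = (2 * Real.pi * ((i / 2 : ℕ) : ℝ) * x + (trigPhase i + k * (Real.pi / 2))) +
        (2 * Real.pi * ((j / 2 : ℕ) : ℝ) * x + (trigPhase j + k * (Real.pi / 2))) := by
      rw [Int.cast_add, Int.cast_natCast, Int.cast_natCast]; ring
    rw [h1, h2]
    generalize 2 * Real.pi * ((i / 2 : ℕ) : ℝ) * x + (trigPhase i + k * (Real.pi / 2)) = A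
    generalize 2 * Real.pi * ((j / 2 : ℕ) : ℝ) * x + (trigPhase j + k * (Real.pi / 2)) = B
    rw [Real.cos_sub, Real.cos_add]
    ring
  have hint : ∀ (p : ℤ) (φ : ℝ),
      Integrable (fun x => Real.cos (2 * Real.pi * (p : ℝ) * x + φ)) unifLaw := fun p φ =>
    Integrable.of_bound (C := 1) (by fun_prop) (by simp [Real.abs_cos_le_one])
  simp_rw [key]
  rw [integral_const_mul, integral_add (hint _ _) (hint _ _), integral_cos_int, integral_cos_int]
  -- The frequencies add to zero only if both indices are `1`, which `hij` excludes.
  have hs : ((i / 2 : ℕ) + (j / 2 : ℕ) : ℤ) ≠ 0 := by omega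
  rw [if_neg hs]
  split_ifs with hd
  · have hm : i / 2 = j / 2 := by omega
    have h1 : i ≠ 1 := by omega
    have h2 : j ≠ 1 := by omega
    -- Equal frequencies with distinct indices form a cosine–sine pair, whose phases differ by
    -- `π/2`.
    have : Real.cos (trigPhase i - trigPhase j) = 0 := by
      unfold trigPhase
      by_cases he : Even i
      · have : ¬ Even j := by rw [Nat.even_iff] at *; omega
        simp [h1, h2, he, this]
      · have : Even j := by rw [Nat.even_iff] at *; omega
        simp [h1, h2, he, this]
    rw [this]; simp
  · simp

theorem integral_trigBasis_mul {i j : ℕ} (hi : 1 ≤ i) (hj : 1 ≤ j) :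
    ∫ x, trigBasis i x * trigBasis j x ∂unifLaw = if i = j then 1 else 0 := by
  split_ifs with h
  · subst h
    have key : ∀ x, trigBasis i x * trigBasis i x = trigAmp i ^ 2 / 2 *
      (1 + Real.cos (2 * Real.pi * ((2 * (i / 2 : ℕ) : ℤ) : ℝ) * x + 2 * trigPhase i)) := by
      intro x
      rw [← trigDeriv_zero]
      unfold trigDeriv
      have : 2 * Real.pi * ((2 * (i / 2 : ℕ) : ℤ) : ℝ) * x + 2 * trigPhase i =
        2 * (2 * Real.pi * ((i / 2 : ℕ) : ℝ) * x + (trigPhase i + (0 : ℕ) * (Real.pi / 2))) := by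
        rw [Int.cast_mul, Int.cast_natCast, Int.cast_ofNat, Nat.cast_zero]; ring
      rw [this, Real.cos_two_mul]
      ring
    simp_rw [key]
    rw [integral_const_mul, integral_add (integrable_const _)
      (Integrable.of_bound (C := 1) (by fun_prop) (by simp [Real.abs_cos_le_one])),
      integral_cos_int]
    by_cases h1 : i = 1
    · simp [h1, trigAmp, trigPhase]; norm_num
    · have : (2 * (i / 2 : ℕ) : ℤ) ≠ 0 := by omega
      rw [if_neg this]
      simp [trigAmp, h1]
  · simpa [trigDeriv_zero] using integral_trigDeriv_mul 0 hi hj h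

theorem integrable_trigDeriv_mul (k i j : ℕ) :
    Integrable (fun x => trigDeriv k i x * trigDeriv k j x) unifLaw :=
  Integrable.of_bound (C := (Real.sqrt 2 * (Real.pi * i) ^ k) * (Real.sqrt 2 * (Real.pi * j) ^ k))
    ((continuous_trigDeriv k i).mul (continuous_trigDeriv k j)).aestronglyMeasurable
    (Filter.Eventually.of_forall fun x => by
      rw [Real.norm_eq_abs, abs_mul]
      exact mul_le_mul (abs_trigDeriv_le k i x) (abs_trigDeriv_le k j x) (abs_nonneg _)
        (by positivity))

theorem integral_trigDeriv_sq_le (k i : ℕ) :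
    ∫ x, trigDeriv k i x * trigDeriv k i x ∂unifLaw ≤ 2 * (Real.pi * i) ^ (2 * k) := by
  have : ∫ x, trigDeriv k i x * trigDeriv k i x ∂unifLaw ≤
      ∫ _, 2 * (Real.pi * i) ^ (2 * k) ∂unifLaw := by
    refine integral_mono (integrable_trigDeriv_mul k i i) (integrable_const _) fun x => ?_
    have h := abs_trigDeriv_le k i x
    have := mul_self_le_mul_self (abs_nonneg _) h
    rw [abs_mul_abs_self] at this
    refine this.trans (le_of_eq ?_)
    have h2 : Real.sqrt 2 * Real.sqrt 2 = 2 := Real.mul_self_sqrt (by norm_num)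
    rw [mul_mul_mul_comm, h2]
    ring
  simpa using this

/-! ### Termwise differentiation and Parseval for trigonometric series. -/

section Series

variable {h : ℕ → ℝ} {k : ℕ}

theorem summable_of_summable_pow_mul (hk : Summable fun j : ℕ => ((j + 1 : ℕ) : ℝ) ^ k * |h j|)
    {m : ℕ} (hm : m ≤ k) : Summable fun j : ℕ => ((j + 1 : ℕ) : ℝ) ^ m * |h j| := by
  refine Summable.of_nonneg_of_le (fun j => by positivity) (fun j => ?_) hk
  have : (1 : ℝ) ≤ ((j + 1 : ℕ) : ℝ) := by simp
  gcongr

theorem norm_mul_trigDeriv_le (m j : ℕ) (c x : ℝ) :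
    ‖c * trigDeriv m (j + 1) x‖ ≤
      Real.sqrt 2 * Real.pi ^ m * (((j + 1 : ℕ) : ℝ) ^ m * |c|) := by
  rw [Real.norm_eq_abs, abs_mul]
  calc |c| * |trigDeriv m (j + 1) x| ≤ |c| * (Real.sqrt 2 * (Real.pi * ((j + 1 : ℕ) : ℝ)) ^ m) :=
        mul_le_mul_of_nonneg_left (abs_trigDeriv_le m (j + 1) x) (abs_nonneg _)
    _ = _ := by rw [mul_pow]; ring

theorem iteratedDeriv_mul_trigDeriv (c : ℝ) (i m : ℕ) :
    iteratedDeriv m (fun x => c * trigDeriv 0 i x) = fun x => c * trigDeriv m i x := by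
  induction m with
  | zero => simp
  | succ m ih =>
    rw [iteratedDeriv_succ, ih]
    ext x
    exact ((hasDerivAt_trigDeriv m i x).const_mul c).deriv

theorem contDiff_mul_trigDeriv (c : ℝ) (i : ℕ) (N : WithTop ℕ∞) :
    ContDiff ℝ N (fun x => c * trigDeriv 0 i x) := by
  unfold trigDeriv; fun_prop

theorem contDiff_trigSeries (hk : Summable fun j : ℕ => ((j + 1 : ℕ) : ℝ) ^ k * |h j|) :
    ContDiff ℝ k (fun x => ∑' j, h j * trigDeriv 0 (j + 1) x) := by
  have := contDiff_tsum (𝕜 := ℝ) (N := (k : ℕ∞)) (f := fun j x => h j * trigDeriv 0 (j + 1) x)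
    (v := fun m j => Real.sqrt 2 * Real.pi ^ m * (((j + 1 : ℕ) : ℝ) ^ m * |h j|))
    (fun j => contDiff_mul_trigDeriv _ _ _)
    (fun m hm => (summable_of_summable_pow_mul hk (by exact_mod_cast hm)).mul_left _)
    (fun m j x _ => by
      rw [norm_iteratedFDeriv_eq_norm_iteratedDeriv, iteratedDeriv_mul_trigDeriv]
      exact norm_mul_trigDeriv_le _ _ _ _)
  exact_mod_cast this

theorem iteratedDeriv_trigSeries (hk : Summable fun j : ℕ => ((j + 1 : ℕ) : ℝ) ^ k * |h j|)
    {m : ℕ} (hm : m ≤ k) :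
    iteratedDeriv m (fun x => ∑' j, h j * trigDeriv 0 (j + 1) x) =
      fun x => ∑' j, h j * trigDeriv m (j + 1) x := by
  induction m with
  | zero => simp
  | succ m ih =>
    rw [iteratedDeriv_succ, ih (by omega)]
    ext x
    refine (hasDerivAt_tsum (u := fun j => Real.sqrt 2 * Real.pi ^ (m + 1) *
      (((j + 1 : ℕ) : ℝ) ^ (m + 1) * |h j|))
      ((summable_of_summable_pow_mul hk hm).mul_left _)
      (fun j y => (hasDerivAt_trigDeriv m (j + 1) y).const_mul (h j))
      (fun j y => norm_mul_trigDeriv_le _ _ _ _) (y₀ := 0) ?_ x).deriv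
    exact Summable.of_norm_bounded
      ((summable_of_summable_pow_mul hk (by omega : m ≤ k)).mul_left (Real.sqrt 2 * Real.pi ^ m))
      (fun j => norm_mul_trigDeriv_le _ _ _ _)

theorem integral_trigSeries_mul {g : ℝ → ℝ} (hg : Continuous g) {B : ℝ} (hB : ∀ x, |g x| ≤ B)
    (hk : Summable fun j : ℕ => ((j + 1 : ℕ) : ℝ) ^ k * |h j|) :
    HasSum (fun j => h j * ∫ x, trigDeriv k (j + 1) x * g x ∂unifLaw)
      (∫ x, (∑' j, h j * trigDeriv k (j + 1) x) * g x ∂unifLaw) := by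
  have hB0 : 0 ≤ B := (abs_nonneg _).trans (hB 0)
  have hbd : ∀ j x, ‖h j * trigDeriv k (j + 1) x * g x‖ ≤
      Real.sqrt 2 * Real.pi ^ k * (((j + 1 : ℕ) : ℝ) ^ k * |h j|) * B := fun j x => by
    rw [norm_mul]
    exact mul_le_mul (norm_mul_trigDeriv_le _ _ _ _) (hB x) (norm_nonneg _) (by positivity)
  have hcont : ∀ j, Continuous fun x => h j * trigDeriv k (j + 1) x * g x := fun j =>
    (continuous_const.mul (continuous_trigDeriv k (j + 1))).mul hg
  have hint : ∀ j, Integrable (fun x => h j * trigDeriv k (j + 1) x * g x) unifLaw := fun j =>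
    Integrable.of_bound (hcont j).aestronglyMeasurable _ (Filter.Eventually.of_forall (hbd j))
  have := hasSum_integral_of_summable_integral_norm hint
    (Summable.of_nonneg_of_le (fun j => integral_nonneg fun x => norm_nonneg _) (fun j => by
      have : ∫ x, ‖h j * trigDeriv k (j + 1) x * g x‖ ∂unifLaw ≤
        ∫ _, Real.sqrt 2 * Real.pi ^ k * (((j + 1 : ℕ) : ℝ) ^ k * |h j|) * B ∂unifLaw :=
        integral_mono (hint j).norm (integrable_const _) (hbd j)
      simpa using this) ((hk.mul_left (Real.sqrt 2 * Real.pi ^ k)).mul_right B))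
  convert! this using 1
  · ext j
    simp_rw [mul_assoc]
    rw [integral_const_mul]
  · congr 1
    ext x
    rw [tsum_mul_right]

theorem continuous_trigSeries (hk : Summable fun j : ℕ => ((j + 1 : ℕ) : ℝ) ^ k * |h j|) :
    Continuous fun x => ∑' j, h j * trigDeriv k (j + 1) x :=
  continuous_tsum (fun j => continuous_const.mul (continuous_trigDeriv k (j + 1)))
    (hk.mul_left (Real.sqrt 2 * Real.pi ^ k)) fun _ _ => norm_mul_trigDeriv_le _ _ _ _

theorem abs_trigSeries_le (hk : Summable fun j : ℕ => ((j + 1 : ℕ) : ℝ) ^ k * |h j|) (x : ℝ) :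
    |∑' j, h j * trigDeriv k (j + 1) x| ≤
      ∑' j, Real.sqrt 2 * Real.pi ^ k * (((j + 1 : ℕ) : ℝ) ^ k * |h j|) :=
  tsum_of_norm_bounded (hk.mul_left (Real.sqrt 2 * Real.pi ^ k)).hasSum
    fun _ => norm_mul_trigDeriv_le _ _ _ _

/-- Parseval's identity for the `k`-th derivative of a trigonometric series. -/
theorem hasSum_integral_trigSeries_sq
    (hk : Summable fun j : ℕ => ((j + 1 : ℕ) : ℝ) ^ k * |h j|) :
    HasSum (fun j => h j ^ 2 * ∫ x, trigDeriv k (j + 1) x * trigDeriv k (j + 1) x ∂unifLaw)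
      (∫ x, (∑' j, h j * trigDeriv k (j + 1) x) ^ 2 ∂unifLaw) := by
  have h1 := integral_trigSeries_mul (continuous_trigSeries hk) (abs_trigSeries_le hk) hk
  convert! h1 using 1
  · ext j
    have h2 := integral_trigSeries_mul (continuous_trigDeriv k (j + 1))
      (abs_trigDeriv_le k (j + 1)) hk
    have h3 : ∫ x, trigDeriv k (j + 1) x * ∑' i, h i * trigDeriv k (i + 1) x ∂unifLaw =
        h j * ∫ x, trigDeriv k (j + 1) x * trigDeriv k (j + 1) x ∂unifLaw := by
      simp_rw [mul_comm (trigDeriv k (j + 1) _) (∑' i, _)]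
      refine h2.unique (hasSum_single j fun i hi => ?_)
      rw [integral_trigDeriv_mul k (by omega) (by omega) (by omega), mul_zero]
    rw [h3]; ring
  · simp_rw [sq]

theorem integral_trigSeries_sq_le (hk : Summable fun j : ℕ => ((j + 1 : ℕ) : ℝ) ^ k * |h j|)
    {S : ℝ} (hS : HasSum (fun j => h j ^ 2 * (2 * (Real.pi * ((j + 1 : ℕ) : ℝ)) ^ (2 * k))) S) :
    ∫ x, (∑' j, h j * trigDeriv k (j + 1) x) ^ 2 ∂unifLaw ≤ S :=
  hasSum_le (fun j => mul_le_mul_of_nonneg_left (integral_trigDeriv_sq_le k (j + 1)) (sq_nonneg _))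
    (hasSum_integral_trigSeries_sq hk) hS

end Series

/-! ### Completeness of the basis and pointwise Fourier inversion. -/

theorem trigCoef_eq_intervalIntegral (f : ℝ → ℝ) (i : ℕ) :
    trigCoef f i = ∫ x in (0 : ℝ)..1, f x * trigBasis i x :=
  integral_unifLaw _

theorem integral_mul_cos_eq_zero {g : ℝ → ℝ} (h0 : ∀ j : ℕ, trigCoef g (j + 1) = 0) (n : ℤ) :
    ∫ x in (0 : ℝ)..1, g x * Real.cos (2 * Real.pi * n * x) = 0 := by
  by_cases hn : n = 0
  · have := h0 0
    rw [trigCoef_eq_intervalIntegral] at this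
    simpa [hn, trigBasis] using this
  · have hp : 1 ≤ n.natAbs := Int.natAbs_pos.2 hn
    have := h0 (2 * n.natAbs - 1)
    rw [Nat.sub_add_cancel (by omega), trigCoef_eq_intervalIntegral] at this
    have h1 : ∀ x, g x * trigBasis (2 * n.natAbs) x =
        Real.sqrt 2 * (g x * Real.cos (2 * Real.pi * n * x)) := by
      intro x
      have h2 : Real.cos (2 * Real.pi * n * x) = Real.cos (2 * Real.pi * (n.natAbs : ℝ) * x) := by
        rcases Int.natAbs_eq n with h | h
        · conv_lhs => rw [h]
          simp
        · conv_lhs => rw [h]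
          rw [← Real.cos_neg]
          simp
      rw [h2, trigBasis, if_neg (by omega), if_pos (by simp),
        Nat.mul_div_cancel_left _ (by norm_num)]
      ring
    simp_rw [h1] at this
    rw [intervalIntegral.integral_const_mul] at this
    exact (mul_eq_zero.1 this).resolve_left (by positivity)

theorem integral_mul_sin_eq_zero {g : ℝ → ℝ} (h0 : ∀ j : ℕ, trigCoef g (j + 1) = 0) (n : ℤ) :
    ∫ x in (0 : ℝ)..1, g x * Real.sin (2 * Real.pi * n * x) = 0 := by
  by_cases hn : n = 0
  · simp [hn]
  · have hp : 1 ≤ n.natAbs := Int.natAbs_pos.2 hn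
    have := h0 (2 * n.natAbs)
    rw [trigCoef_eq_intervalIntegral] at this
    have h1 : ∀ x, g x * trigBasis (2 * n.natAbs + 1) x =
        Real.sqrt 2 * (g x * Real.sin (2 * Real.pi * (n.natAbs : ℝ) * x)) := by
      intro x
      have h2 : (2 * n.natAbs + 1) / 2 = n.natAbs := by omega
      rw [trigBasis, if_neg (by omega), if_neg (by simp), h2]
      ring
    simp_rw [h1] at this
    rw [intervalIntegral.integral_const_mul] at this
    have h3 := (mul_eq_zero.1 this).resolve_left (by positivity)
    rcases Int.natAbs_eq n with h | h
    · rw [h]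
      simpa using h3
    · rw [h]
      simpa using h3

/-- Vanishing real coefficients force all complex Fourier coefficients to vanish, so Parseval gives
`∫ g² = 0`. Continuity upgrades this to every point, endpoints included; no periodicity is assumed.
-/
theorem eqOn_zero_of_trigCoef_eq_zero {g : ℝ → ℝ} (hg : ContinuousOn g (Icc 0 1))
    (h0 : ∀ j : ℕ, trigCoef g (j + 1) = 0) {x : ℝ} (hx : x ∈ Icc (0 : ℝ) 1) : g x = 0 := by
  have hgi : ContinuousOn g (uIcc 0 1) := by rwa [uIcc_of_le zero_le_one]
  have hc : ∀ n : ℤ, fourierCoeffOn zero_lt_one (fun x => (g x : ℂ)) n = 0 := by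
    intro n
    rw [fourierCoeffOn_eq_integral]
    have h1 : ∀ x : ℝ, (fourier (-n) (x : AddCircle ((1 : ℝ) - 0))) • (g x : ℂ) =
        ((g x * Real.cos (2 * Real.pi * n * x) : ℝ) : ℂ) -
          Complex.I * ((g x * Real.sin (2 * Real.pi * n * x) : ℝ) : ℂ) := by
      intro x
      rw [fourier_coe_apply]
      have : 2 * (Real.pi : ℂ) * Complex.I * ((-n : ℤ) : ℂ) * (x : ℂ) / (((1 : ℝ) - 0 : ℝ) : ℂ) =
          ((-(2 * Real.pi * n * x) : ℝ) : ℂ) * Complex.I := by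
        push_cast; ring
      rw [this, Complex.exp_mul_I, ← Complex.ofReal_cos, ← Complex.ofReal_sin, Real.cos_neg,
        Real.sin_neg]
      push_cast
      simp only [smul_eq_mul]
      ring
    simp_rw [h1]
    rw [intervalIntegral.integral_sub, intervalIntegral.integral_const_mul,
      intervalIntegral.integral_ofReal, intervalIntegral.integral_ofReal,
      integral_mul_cos_eq_zero h0, integral_mul_sin_eq_zero h0]
    · simp
    · exact ContinuousOn.intervalIntegrable
        (Complex.continuous_ofReal.comp_continuousOn (hgi.mul (by fun_prop)))
    · exact ContinuousOn.intervalIntegrable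
        (continuousOn_const.mul (Complex.continuous_ofReal.comp_continuousOn
          (hgi.mul (by fun_prop))))
  obtain ⟨B, hB⟩ := isCompact_Icc.exists_bound_of_continuousOn hg
  have hL2 : MemLp (fun x => (g x : ℂ)) 2 (volume.restrict (Ioc 0 1)) := by
    refine MemLp.of_bound ?_ B ?_
    · exact ((Complex.continuous_ofReal.comp_continuousOn hg).mono
        Ioc_subset_Icc_self).aestronglyMeasurable measurableSet_Ioc
    · filter_upwards [ae_restrict_mem measurableSet_Ioc] with y hy
      simpa using hB y (Ioc_subset_Icc_self hy)
  have hP := hasSum_sq_fourierCoeffOn zero_lt_one hL2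
  simp only [hc, norm_zero, ne_eq, OfNat.ofNat_ne_zero, not_false_eq_true, zero_pow] at hP
  have hz : ∫ y in (0 : ℝ)..1, g y ^ 2 = 0 := by
    have := hP.unique hasSum_zero
    simpa using this
  by_contra hne
  have : 0 < ∫ y in (0 : ℝ)..1, g y ^ 2 :=
    intervalIntegral.integral_pos zero_lt_one (hg.pow 2) (fun y _ => sq_nonneg _)
      ⟨x, hx, by positivity⟩
  linarith

/-- Pointwise Fourier inversion on `[0,1]` for absolutely convergent Fourier series. -/
theorem hasSum_trigCoef_mul_trigBasis {f : ℝ → ℝ} (hf : ContinuousOn f (Icc 0 1))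
    (hs : Summable fun j : ℕ => |trigCoef f (j + 1)|) {x : ℝ} (hx : x ∈ Icc (0 : ℝ) 1) :
    HasSum (fun j : ℕ => trigCoef f (j + 1) * trigBasis (j + 1) x) (f x) := by
  have hs0 : Summable fun j : ℕ => ((j + 1 : ℕ) : ℝ) ^ 0 * |trigCoef f (j + 1)| := by simpa using hs
  set F : ℝ → ℝ := fun x => ∑' j, trigCoef f (j + 1) * trigDeriv 0 (j + 1) x with hF
  have hFc : Continuous F := continuous_trigSeries hs0
  have hFs : Summable fun j : ℕ => trigCoef f (j + 1) * trigDeriv 0 (j + 1) x :=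
    Summable.of_norm_bounded (hs0.mul_left (Real.sqrt 2 * Real.pi ^ 0))
      (fun j => norm_mul_trigDeriv_le _ _ _ _)
  -- The sum `F` of the series is continuous and shares the coefficients of `f`, so completeness
  -- applies to `f - F`.
  have hcoef : ∀ j : ℕ, trigCoef F (j + 1) = trigCoef f (j + 1) := by
    intro j
    have h2 := integral_trigSeries_mul (continuous_trigBasis (j + 1)) (abs_trigBasis_le (j + 1)) hs0
    refine h2.unique ?_
    have h3 := hasSum_single (f := fun i => trigCoef f (i + 1) *
      ∫ x, trigDeriv 0 (i + 1) x * trigBasis (j + 1) x ∂unifLaw) j (fun i hi => by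
        simp only [trigDeriv_zero]
        rw [integral_trigBasis_mul (by omega) (by omega), if_neg (by omega), mul_zero])
    simp only [trigDeriv_zero] at h3 ⊢
    rw [integral_trigBasis_mul (by omega) (by omega), if_pos rfl, mul_one] at h3
    exact h3
  have hfi : ∀ {u : ℝ → ℝ}, ContinuousOn u (Icc 0 1) → ∀ i,
      Integrable (fun x => u x * trigBasis i x) unifLaw := fun {u} hu i =>
    ContinuousOn.integrableOn_Icc (hu.mul (continuous_trigBasis i).continuousOn)
  have := eqOn_zero_of_trigCoef_eq_zero (hf.sub hFc.continuousOn) (fun j => by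
    unfold trigCoef
    simp only [Pi.sub_apply, sub_mul]
    rw [integral_sub (hfi hf _) (hfi hFc.continuousOn _)]
    exact sub_eq_zero.2 (hcoef j).symm) hx
  have hfx : f x = F x := sub_eq_zero.1 this
  rw [hfx]
  simpa [trigDeriv_zero, hF] using hFs.hasSum

/-! ### Effective dimension and its asymptotics. -/

theorem summable_nat_succ_rpow_neg {a : ℝ} (ha : 1 < a) :
    Summable fun j : ℕ => ((j + 1 : ℕ) : ℝ) ^ (-a) :=
  (summable_nat_add_iff 1).2 (Real.summable_nat_rpow.2 (by linarith))

/-- Cut the indices into blocks of length `N = ⌈q⌉₊`. Every term of block `s` is at most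
`(2/(s+1))^a`, so the total is at most `N` times a convergent series, and `N ≤ 2 q`. -/
theorem exists_tsum_min_rpow_le {a : ℝ} (ha : 1 < a) :
    ∃ C : ℝ, 0 < C ∧ ∀ q : ℝ, 1 ≤ q →
      Summable (fun j : ℕ => min 1 ((q / ((j + 1 : ℕ) : ℝ)) ^ a)) ∧
        ∑' j : ℕ, min 1 ((q / ((j + 1 : ℕ) : ℝ)) ^ a) ≤ C * q := by
  have hS := summable_nat_succ_rpow_neg ha
  set S : ℝ := ∑' j : ℕ, ((j + 1 : ℕ) : ℝ) ^ (-a) with hSdef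
  have hS0 : 0 < S := hS.tsum_pos (fun j => by positivity) 0 (by positivity)
  refine ⟨2 * (2 ^ a * S), by positivity, fun q hq => ?_⟩
  set N : ℕ := ⌈q⌉₊ with hN
  have hqN : q ≤ N := Nat.le_ceil q
  have hN0 : N ≠ 0 := by
    intro h
    rw [h] at hqN
    norm_num at hqN
    linarith
  have hNq : (N : ℝ) ≤ 2 * q := by
    have := (Nat.ceil_lt_add_one (by linarith : 0 ≤ q)).le
    linarith
  have : NeZero N := ⟨hN0⟩
  set g : ℕ × Fin N → ℝ := fun p => 2 ^ a * ((p.1 + 1 : ℕ) : ℝ) ^ (-a) with hg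
  have hgs : HasSum g (2 ^ a * S * N) := by
    have h1 : HasSum (fun s : ℕ => 2 ^ a * ((s + 1 : ℕ) : ℝ) ^ (-a) * N) (2 ^ a * S * N) :=
      (hS.hasSum.mul_left _).mul_right _
    have hsum : Summable g := by
      refine (summable_prod_of_nonneg (fun p => by positivity)).2 ⟨fun s => Summable.of_finite, ?_⟩
      refine h1.summable.congr fun s => ?_
      simp [hg, tsum_fintype, mul_comm]
    refine hsum.hasSum_iff.2 ?_
    rw [hsum.tsum_prod, ← h1.tsum_eq]
    exact tsum_congr fun s => by simp [hg, tsum_fintype, mul_comm]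
  have hgs' : HasSum (g ∘ Nat.divModEquiv N) (2 ^ a * S * N) := (Equiv.hasSum_iff _).2 hgs
  have hle : ∀ j : ℕ, min 1 ((q / ((j + 1 : ℕ) : ℝ)) ^ a) ≤ (g ∘ Nat.divModEquiv N) j := by
    intro j
    have hgj : (g ∘ Nat.divModEquiv N) j = 2 ^ a * ((j / N + 1 : ℕ) : ℝ) ^ (-a) := by
      simp [hg, Nat.divModEquiv]
    rw [hgj, Real.rpow_neg (by positivity), ← div_eq_mul_inv, ← Real.div_rpow (by norm_num)
      (by positivity)]
    by_cases hs : j / N = 0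
    · refine (min_le_left _ _).trans (Real.one_le_rpow ?_ (by linarith))
      rw [hs]; norm_num
    · refine (min_le_right _ _).trans (Real.rpow_le_rpow (by positivity) ?_ (by linarith))
      rw [div_le_div_iff₀ (by positivity) (by positivity)]
      have h1 : (N : ℝ) * ((j / N : ℕ) : ℝ) ≤ j := by exact_mod_cast Nat.mul_div_le j N
      have h2 : (1 : ℝ) ≤ ((j / N : ℕ) : ℝ) := by exact_mod_cast Nat.one_le_iff_ne_zero.2 hs
      have h3 : q * ((j / N : ℕ) : ℝ) ≤ N * ((j / N : ℕ) : ℝ) := by gcongr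
      push_cast
      nlinarith
  have hs : Summable (fun j : ℕ => min 1 ((q / ((j + 1 : ℕ) : ℝ)) ^ a)) :=
    Summable.of_nonneg_of_le (fun j => by positivity) hle hgs'.summable
  refine ⟨hs, (hasSum_le hle hs.hasSum hgs').trans ?_⟩
  nlinarith [mul_pos (Real.rpow_pos_of_pos two_pos a) hS0]

/-- The squared rate `(log n / n) ^ (2α / (2α + 1))`. -/
noncomputable def rate (α : ℝ) (n : ℕ) : ℝ := (Real.log n / n) ^ (2 * α / (2 * α + 1))

/-- The order `(log n / n) ^ (-1 / (2α + 1))` of the effective dimension. -/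
noncomputable def effDim (α : ℝ) (n : ℕ) : ℝ := (Real.log n / n) ^ (-(1 / (2 * α + 1)))

/-- The logarithmic level used in the deviation bound for the basis function number `j + 1`. -/
noncomputable def level (n j : ℕ) : ℝ := 20 * Real.log n + 2 * Real.log ((j + 1 : ℕ) : ℝ)

section
variable {α : ℝ} {n : ℕ}

theorem half_le_log (hn : 2 ≤ n) : 1 / 2 ≤ Real.log n := by
  have h1 : Real.log 2 ≤ Real.log n := Real.log_le_log (by norm_num) (by exact_mod_cast hn)
  linarith [Real.log_two_gt_d9]

theorem log_div_pos (hn : 2 ≤ n) : 0 < Real.log n / n := by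
  have := half_le_log hn
  have : (0 : ℝ) < n := by positivity
  positivity

theorem log_div_le_one (n : ℕ) : Real.log n / n ≤ 1 :=
  div_le_one_of_le₀ ((Real.log_le_self (by positivity))) (by positivity)

theorem rate_pos (hn : 2 ≤ n) : 0 < rate α n := Real.rpow_pos_of_pos (log_div_pos hn) _

theorem one_le_effDim (hα : 0 < α) (hn : 2 ≤ n) : 1 ≤ effDim α n :=
  Real.one_le_rpow_of_pos_of_le_one_of_nonpos (log_div_pos hn) (log_div_le_one n)
    (neg_nonpos.2 (by positivity))

theorem effDim_rpow (hα : 0 < α) (hn : 2 ≤ n) : effDim α n ^ (2 * α) = (rate α n)⁻¹ := by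
  rw [effDim, rate, ← Real.rpow_mul (log_div_pos hn).le, ← Real.rpow_neg (log_div_pos hn).le]
  congr 1
  field_simp

theorem effDim_mul_log_div (hα : 0 < α) (hn : 2 ≤ n) :
    effDim α n * Real.log n / n = rate α n := by
  rw [mul_div_assoc, effDim, rate]
  nth_rw 2 [← Real.rpow_one (Real.log n / n)]
  rw [← Real.rpow_add (log_div_pos hn)]
  congr 1
  field_simp
  ring

theorem effDim_eq (hn : 2 ≤ n) : effDim α n = (n / Real.log n) ^ (1 / (2 * α + 1)) := by
  rw [effDim, Real.rpow_neg (log_div_pos hn).le, ← Real.inv_rpow (log_div_pos hn).le, inv_div]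

theorem effDim_le (hα : 1 / 2 < α) (hn : 2 ≤ n) : effDim α n ≤ n := by
  have hl := half_le_log hn
  have hn0 : (2 : ℝ) ≤ n := by exact_mod_cast hn
  have h1 : 1 ≤ (n : ℝ) / Real.log n := by
    rw [le_div_iff₀ (by linarith), one_mul]
    exact Real.log_le_self (by positivity)
  rw [effDim_eq hn]
  calc ((n : ℝ) / Real.log n) ^ (1 / (2 * α + 1)) ≤ ((n : ℝ) / Real.log n) ^ (1 / 2 : ℝ) := by
        refine Real.rpow_le_rpow_of_exponent_le h1 ?_
        rw [div_le_div_iff₀ (by linarith) (by norm_num)]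
        linarith
    _ ≤ n := by
        rw [← Real.sqrt_eq_rpow, Real.sqrt_le_left (by positivity), div_le_iff₀ (by linarith)]
        nlinarith

theorem level_pos (hn : 2 ≤ n) (j : ℕ) : 10 ≤ level n j := by
  have := half_le_log hn
  have : 0 ≤ Real.log ((j + 1 : ℕ) : ℝ) := Real.log_natCast_nonneg _
  unfold level; linarith

/-- The level grows like `log j`, which a sum over about `q = effDim α n` indices must absorb
without an extra logarithm. With `x = q / (j + 1)`, one has `log (j + 1) = log q + log x⁻¹`; the
first part is at most `log n`, and the second is paid for by a small part of the decay `x ^ (2α)`.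
-/
theorem exists_tsum_weight_mul_level_le (hα : 1 / 2 < α) (M : ℝ) :
    ∃ C : ℝ, 0 < C ∧ ∀ n : ℕ, 2 ≤ n → ∀ w : ℕ → ℝ, (∀ j, 0 ≤ w j) → (∀ j, w j ≤ 1) →
      (∀ j, w j ≤ M * (effDim α n / ((j + 1 : ℕ) : ℝ)) ^ (2 * α)) →
      Summable (fun j => w j * level n j) ∧
        ∑' j, w j * level n j ≤ C * (effDim α n * Real.log n) := by
  -- The decay exponent splits as `2α = a + ε`: `ε > 0` is spent on the logarithm, and `a > 1` keeps
  -- the sum convergent.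
  set ε : ℝ := α - 1 / 2 with hε
  have hε0 : 0 < ε := by linarith
  set a : ℝ := α + 1 / 2 with ha
  obtain ⟨C, hC, hCs⟩ := exists_tsum_min_rpow_le (a := a) (by linarith)
  set M' : ℝ := max 1 M with hM'
  have hM1 : 1 ≤ M' := le_max_left _ _
  refine ⟨M' * (22 + 4 / ε) * C, by positivity, fun n hn w hw0 hw1 hwM => ?_⟩
  obtain ⟨hs, hsle⟩ := hCs _ (one_le_effDim (by linarith : 0 < α) hn)
  have hl := half_le_log hn
  have hq1 := one_le_effDim (by linarith : 0 < α) hn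
  have hqn := effDim_le hα hn
  set q := effDim α n
  have hbd : ∀ j, w j * level n j ≤ M' * (22 + 4 / ε) * Real.log n *
      min 1 ((q / ((j + 1 : ℕ) : ℝ)) ^ a) := by
    intro j
    set i : ℝ := ((j + 1 : ℕ) : ℝ) with hi
    have hi0 : 0 < i := by positivity
    set x : ℝ := q / i with hx
    have hx0 : 0 < x := by positivity
    have hlev : level n j ≤ 22 * Real.log n + 4 / ε * Real.log n * x ^ (-ε) := by
      have h1 : Real.log i = Real.log q + Real.log (x⁻¹) := by
        rw [← Real.log_mul (by positivity) (by positivity)]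
        congr 1
        rw [hx]; field_simp
      have h2 : Real.log q ≤ Real.log n := Real.log_le_log (by linarith) hqn
      have h3 : Real.log (x⁻¹) ≤ x ^ (-ε) / ε := by
        rw [Real.rpow_neg hx0.le, ← Real.inv_rpow hx0.le]
        exact Real.log_le_rpow_div (by positivity) hε0
      have h4 : 2 * (x ^ (-ε) / ε) ≤ 4 / ε * Real.log n * x ^ (-ε) := by
        have : 0 < x ^ (-ε) / ε := by positivity
        calc 2 * (x ^ (-ε) / ε) = 4 * (1 / 2) * (x ^ (-ε) / ε) := by ring
          _ ≤ 4 * Real.log n * (x ^ (-ε) / ε) := by gcongr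
          _ = _ := by ring
      have : level n j = 20 * Real.log n + 2 * Real.log i := rfl
      rw [this, h1]
      linarith
    have hw : w j ≤ M' * min 1 (x ^ (2 * α)) := by
      rw [mul_min_of_nonneg _ _ (by linarith), mul_one]
      refine le_min ((hw1 j).trans hM1) ((hwM j).trans ?_)
      gcongr
      exact le_max_right _ _
    have hxe : 0 < x ^ (-ε) := by positivity
    have hmin : min 1 (x ^ (2 * α)) * (22 * Real.log n + 4 / ε * Real.log n * x ^ (-ε)) ≤
        (22 * Real.log n + 4 / ε * Real.log n) * min 1 (x ^ a) := by
      rcases le_total 1 x with h | h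
      · rw [min_eq_left (Real.one_le_rpow h (by linarith)),
          min_eq_left (Real.one_le_rpow h (by linarith)), one_mul, mul_one]
        have : x ^ (-ε) ≤ 1 := Real.rpow_le_one_of_one_le_of_nonpos h (by linarith)
        have h5 : 0 ≤ 4 / ε * Real.log n := by positivity
        nlinarith
      · rw [min_eq_right (Real.rpow_le_one hx0.le h (by linarith)),
          min_eq_right (Real.rpow_le_one hx0.le h (by linarith))]
        have h6 : x ^ (2 * α) * x ^ (-ε) = x ^ a := by
          rw [← Real.rpow_add hx0]; congr 1; rw [hε, ha]; ring
        have h7 : x ^ (2 * α) ≤ x ^ a := Real.rpow_le_rpow_of_exponent_ge hx0 h (by linarith)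
        calc x ^ (2 * α) * (22 * Real.log n + 4 / ε * Real.log n * x ^ (-ε))
            = 22 * Real.log n * x ^ (2 * α) + 4 / ε * Real.log n * (x ^ (2 * α) * x ^ (-ε)) := by
              ring
          _ ≤ 22 * Real.log n * x ^ a + 4 / ε * Real.log n * x ^ a := by
              rw [h6]; gcongr
          _ = _ := by ring
    have hlev0 : 0 ≤ level n j := by linarith [level_pos hn j]
    calc w j * level n j ≤ M' * min 1 (x ^ (2 * α)) *
          (22 * Real.log n + 4 / ε * Real.log n * x ^ (-ε)) :=
          mul_le_mul hw hlev hlev0 (by positivity)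
      _ ≤ M' * ((22 * Real.log n + 4 / ε * Real.log n) * min 1 (x ^ a)) := by
          rw [mul_assoc]; gcongr
      _ = _ := by ring
  have hsum : Summable fun j => w j * level n j :=
    Summable.of_nonneg_of_le (fun j => mul_nonneg (hw0 j) (by linarith [level_pos hn j])) hbd
      (hs.mul_left _)
  refine ⟨hsum, (hsum.tsum_le_tsum hbd (hs.mul_left _)).trans ?_⟩
  rw [tsum_mul_left]
  calc _ ≤ M' * (22 + 4 / ε) * Real.log n * (C * q) := by gcongr
    _ = _ := by ring

/-- The effective dimension grows at most like `n ^ (1/(2α+1))`, and `α > 1/2` makes this exponent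
less than `1/2`, leaving a power of `n` to beat the logarithm. -/
theorem tendsto_effDim_mul_log_div_sqrt (hα : 1 / 2 < α) :
    Filter.Tendsto (fun n : ℕ => effDim α n * Real.log n * Real.sqrt (8 / n)) Filter.atTop
      (nhds 0) := by
  set s : ℝ := 1 / 2 - 1 / (2 * α + 1) with hs
  have hs0 : 0 < s := by
    have : 1 / (2 * α + 1) < 1 / 2 := one_div_lt_one_div_of_lt (by norm_num) (by linarith)
    linarith
  have h1 : Filter.Tendsto (fun n : ℕ => Real.sqrt 8 * (Real.log n / (n : ℝ) ^ s)) Filter.atTop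
      (nhds (Real.sqrt 8 * 0)) :=
    (((isLittleO_log_rpow_atTop hs0).tendsto_div_nhds_zero).comp
      tendsto_natCast_atTop_atTop).const_mul _
  rw [mul_zero] at h1
  refine squeeze_zero' (Filter.Eventually.of_forall fun n => ?_) ?_ h1
  · exact mul_nonneg (mul_nonneg (Real.rpow_nonneg (by positivity) _) (by positivity))
      (Real.sqrt_nonneg _)
  · filter_upwards [Filter.eventually_ge_atTop 3] with n hn
    have hn0 : (3 : ℝ) ≤ n := by exact_mod_cast hn
    have hl : 1 ≤ Real.log n := by
      rw [Real.le_log_iff_exp_le (by linarith)]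
      linarith [Real.exp_one_lt_d9]
    rw [effDim_eq (by omega)]
    have h2 : ((n : ℝ) / Real.log n) ^ (1 / (2 * α + 1)) ≤ (n : ℝ) ^ (1 / (2 * α + 1)) := by
      have : 0 ≤ 1 / (2 * α + 1) := by positivity
      exact Real.rpow_le_rpow (by positivity) (div_le_self (by positivity) hl) this
    have h3 : Real.sqrt (8 / n) = Real.sqrt 8 * (n : ℝ) ^ (-(1 / 2) : ℝ) := by
      rw [Real.sqrt_div (by norm_num), Real.rpow_neg (by positivity), ← Real.sqrt_eq_rpow,
        div_eq_mul_inv]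
    rw [h3]
    calc _ ≤ (n : ℝ) ^ (1 / (2 * α + 1)) * Real.log n * (Real.sqrt 8 * (n : ℝ) ^ (-(1 / 2) : ℝ)) := by
          gcongr
      _ = Real.sqrt 8 * (Real.log n * ((n : ℝ) ^ (1 / (2 * α + 1)) * (n : ℝ) ^ (-(1 / 2) : ℝ))) := by
          ring
      _ = _ := by
          rw [← Real.rpow_add (by positivity), div_eq_mul_inv (Real.log n), ← Real.rpow_neg (by positivity)]
          congr 3
          rw [hs]; ring

end

/-! ### Deterministic analysis of kernel ridge regression. -/

theorem summable_abs_mul_and_sq_tsum_le {a b : ℕ → ℝ} (ha : Summable fun j => a j ^ 2)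
    (hb : Summable fun j => b j ^ 2) :
    Summable (fun j => |a j * b j|) ∧
      ∑' j, |a j * b j| ≤ Real.sqrt ((∑' j, a j ^ 2) * ∑' j, b j ^ 2) := by
  have h : ∀ s : Finset ℕ, ∑ j ∈ s, |a j * b j| ≤
      Real.sqrt ((∑' j, a j ^ 2) * ∑' j, b j ^ 2) := by
    intro s
    refine Real.le_sqrt_of_sq_le ?_
    have h1 := Finset.sum_mul_sq_le_sq_mul_sq s (fun j => |a j|) (fun j => |b j|)
    simp only [← abs_mul, sq_abs] at h1
    refine h1.trans (mul_le_mul (ha.sum_le_tsum s fun j _ => sq_nonneg _)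
      (hb.sum_le_tsum s fun j _ => sq_nonneg _) (Finset.sum_nonneg fun j _ => sq_nonneg _)
      (tsum_nonneg fun j => sq_nonneg _))
  have hs := summable_of_sum_le (fun j => abs_nonneg _) h
  exact ⟨hs, hs.tsum_le_of_sum_le h⟩

theorem hasSum_mul_self {g : ℕ → ℝ} (h0 : ∀ j, 0 ≤ g j) (hg : Summable g) :
    HasSum (fun p : ℕ × ℕ => g p.1 * g p.2) ((∑' j, g j) ^ 2) := by
  rw [sq]
  exact hg.hasSum.mul hg.hasSum (hg.mul_of_nonneg hg h0 h0)

section RidgeRegression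

variable {n : ℕ} {ψ : ℕ → Fin n → ℝ} {μ θ : ℕ → ℝ} {G : Fin n → Fin n → ℝ} {ε f a : Fin n → ℝ}
  {m : ℝ}

/-- The basis coefficients of the estimation error of kernel ridge regression, with dual
coefficients `a`. -/
def errCoef (ψ : ℕ → Fin n → ℝ) (μ θ : ℕ → ℝ) (a : Fin n → ℝ) (j : ℕ) : ℝ :=
  μ j * (∑ l, a l * ψ j l) - θ j

/-- By the normal equations the fitted value is the response minus `m * a l`; subtracting `f l`
leaves the noise minus `m * a l`. -/
theorem hasSum_errCoef (hG : ∀ l l', HasSum (fun j => μ j * ψ j l * ψ j l') (G l l'))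
    (hf : ∀ l, HasSum (fun j => θ j * ψ j l) (f l))
    (ha : ∀ l, (∑ l', G l l' * a l') + m * a l = f l + ε l) (l : Fin n) :
    HasSum (fun j => errCoef ψ μ θ a j * ψ j l) (ε l - m * a l) := by
  have h1 : HasSum (fun j => ∑ l', μ j * ψ j l * ψ j l' * a l') (∑ l', G l l' * a l') :=
    hasSum_sum fun l' _ => (hG l l').mul_right _
  have h2 : ε l - m * a l = (∑ l', G l l' * a l') - f l := by linarith [ha l]
  rw [h2]
  refine (h1.sub (hf l)).congr_fun fun j => ?_
  rw [errCoef, sub_mul, Finset.mul_sum, Finset.sum_mul]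
  congr 1
  exact Finset.sum_congr rfl fun l' _ => by ring

/-- Qualitative finiteness of the energy, needed before any rearrangement: the fitted part
contributes `μ j` times a bounded factor, the target part `θ j ^ 2 / μ j`. -/
theorem summable_errCoef_sq_div (hμ : ∀ j, 0 < μ j) (hμs : Summable μ) {B : ℝ}
    (hψ : ∀ j l, |ψ j l| ≤ B) (hθ : Summable fun j => θ j ^ 2 / μ j) :
    Summable fun j => errCoef ψ μ θ a j ^ 2 / μ j := by
  have hb : ∀ j, |∑ l, a l * ψ j l| ≤ ∑ l, |a l| * B := fun j =>
    (Finset.abs_sum_le_sum_abs _ _).trans (Finset.sum_le_sum fun l _ => by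
      rw [abs_mul]; exact mul_le_mul_of_nonneg_left (hψ j l) (abs_nonneg _))
  refine Summable.of_nonneg_of_le (fun j => div_nonneg (sq_nonneg _) (hμ j).le) (fun j => ?_)
    ((hμs.mul_right (2 * (∑ l, |a l| * B) ^ 2)).add (hθ.mul_left 2))
  have h1 := sq_le_sq' (neg_le_of_abs_le (hb j)) (le_of_abs_le (hb j))
  rw [div_le_iff₀ (hμ j), add_mul, mul_assoc 2, div_mul_cancel₀ _ (hμ j).ne', errCoef]
  set b := ∑ l, a l * ψ j l
  have h2 : (μ j * b - θ j) ^ 2 ≤ 2 * (μ j * b) ^ 2 + 2 * θ j ^ 2 := by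
    nlinarith [sq_nonneg (μ j * b + θ j)]
  have h3 : (μ j) ^ 2 * b ^ 2 ≤ (μ j) ^ 2 * (∑ l, |a l| * B) ^ 2 := by gcongr
  nlinarith

/-- The first order condition of kernel ridge regression, tested against the error. -/
theorem errCoef_energy_identity (hμ : ∀ j, 0 < μ j)
    (hG : ∀ l l', HasSum (fun j => μ j * ψ j l * ψ j l') (G l l'))
    (hf : ∀ l, HasSum (fun j => θ j * ψ j l) (f l))
    (ha : ∀ l, (∑ l', G l l' * a l') + m * a l = f l + ε l)
    (hQ : Summable fun j => errCoef ψ μ θ a j ^ 2 / μ j)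
    (hP : Summable fun j => errCoef ψ μ θ a j * θ j / μ j) :
    ∑ l, (ε l - m * a l) ^ 2 + m * ∑' j, errCoef ψ μ θ a j ^ 2 / μ j =
      ∑ l, ε l * (ε l - m * a l) - m * ∑' j, errCoef ψ μ θ a j * θ j / μ j := by
  have h1 : HasSum (fun j => ∑ l, errCoef ψ μ θ a j * ψ j l * a l)
      (∑ l, (ε l - m * a l) * a l) :=
    hasSum_sum fun l _ => (hasSum_errCoef hG hf ha l).mul_right _
  have h2 : HasSum (fun j => ∑ l, errCoef ψ μ θ a j * ψ j l * a l)
      ((∑' j, errCoef ψ μ θ a j ^ 2 / μ j) + ∑' j, errCoef ψ μ θ a j * θ j / μ j) := by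
    refine (hQ.hasSum.add hP.hasSum).congr_fun fun j => ?_
    have : ∑ l, errCoef ψ μ θ a j * ψ j l * a l =
        errCoef ψ μ θ a j * ∑ l, a l * ψ j l := by
      rw [Finset.mul_sum]; exact Finset.sum_congr rfl fun l _ => by ring
    rw [this]
    -- Solving the definition of `errCoef` for the dual sum eliminates `a` in favour of the error.
    have h3 : ∑ l, a l * ψ j l = (errCoef ψ μ θ a j + θ j) / μ j := by
      rw [errCoef]; field_simp [(hμ j).ne']; ring
    rw [h3]
    ring
  have h4 := h1.unique h2
  have h5 : ∑ l, (ε l - m * a l) ^ 2 =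
      ∑ l, ε l * (ε l - m * a l) - m * ∑ l, (ε l - m * a l) * a l := by
    rw [Finset.mul_sum, ← Finset.sum_sub_distrib]
    exact Finset.sum_congr rfl fun l _ => by ring
  rw [h5, h4]
  ring

/-- A quadratic form in empirical covariances is close to its expectation as soon as the
empirical covariances are. -/
theorem abs_sum_sq_sub_le {h s : ℕ → ℝ} {H : Fin n → ℝ} {t : ℝ}
    (hH : ∀ l, HasSum (fun j => h j * ψ j l) (H l))
    (hhs : Summable fun j => |h j * s j|) (hh : Summable fun j => |h j|)
    (hA : ∀ i j, |∑ l, (ψ i l * ψ j l - if i = j then 1 else 0)| ≤ t * (s i * s j))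
    {B : ℝ} (hψ : ∀ j l, |ψ j l| ≤ B) (ht : 0 ≤ t) :
    |∑ l, H l ^ 2 - n * ∑' j, h j ^ 2| ≤ t * (∑' j, |h j * s j|) ^ 2 := by
  have hsψ : ∀ l, Summable fun j => ‖h j * ψ j l‖ := fun l =>
    Summable.of_nonneg_of_le (fun j => norm_nonneg _) (fun j => by
      rw [norm_mul]
      exact mul_le_mul_of_nonneg_left (hψ j l) (norm_nonneg _)) (hh.mul_right B)
  have h1 : ∀ l, HasSum (fun p : ℕ × ℕ => (h p.1 * ψ p.1 l) * (h p.2 * ψ p.2 l)) (H l ^ 2) := by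
    intro l
    rw [sq]
    exact (hH l).mul (hH l) (summable_mul_of_summable_norm (hsψ l) (hsψ l))
  have hhn : Summable fun j => ‖h j‖ := hh
  have h2 : HasSum (fun p : ℕ × ℕ => if p.1 = p.2 then h p.1 * h p.2 else 0)
      (∑' j, h j ^ 2) := by
    have hsq : Summable fun j => h j ^ 2 := by
      have := (summable_mul_of_summable_norm hhn hhn).comp_injective
        (i := fun j : ℕ => (j, j)) (fun a b hab => (Prod.mk.inj hab).1)
      refine this.congr fun j => ?_
      simp [sq]
    have hinj : Function.Injective (fun j : ℕ => (j, j)) := fun a b hab => (Prod.mk.inj hab).1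
    refine (hinj.hasSum_iff ?_).1 ?_
    · rintro ⟨i, j⟩ hij
      rw [if_neg]
      exact fun hc => hij ⟨i, Prod.ext rfl hc⟩
    · refine hsq.hasSum.congr_fun fun j => ?_
      simp [sq]
  have h3 : HasSum (fun p : ℕ × ℕ => h p.1 * h p.2 *
      ∑ l, (ψ p.1 l * ψ p.2 l - if p.1 = p.2 then 1 else 0))
      (∑ l, H l ^ 2 - n * ∑' j, h j ^ 2) := by
    have hsum : HasSum (fun p : ℕ × ℕ => ∑ l, (h p.1 * ψ p.1 l) * (h p.2 * ψ p.2 l))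
        (∑ l, H l ^ 2) := hasSum_sum fun l _ => h1 l
    have hpt : ∀ p : ℕ × ℕ, h p.1 * h p.2 *
        ∑ l, (ψ p.1 l * ψ p.2 l - if p.1 = p.2 then 1 else 0) =
        ∑ l, (h p.1 * ψ p.1 l) * (h p.2 * ψ p.2 l) -
          n * (if p.1 = p.2 then h p.1 * h p.2 else 0) := by
      intro p
      rw [Finset.sum_sub_distrib, Finset.sum_const, Finset.card_univ, Fintype.card_fin,
        nsmul_eq_mul, mul_sub, Finset.mul_sum]
      congr 1
      · exact Finset.sum_congr rfl fun l _ => by ring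
      · split_ifs <;> ring
    simp_rw [hpt]
    exact hsum.sub (h2.mul_left (n : ℝ))
  have h4 : HasSum (fun p : ℕ × ℕ => t * (|h p.1 * s p.1| * |h p.2 * s p.2|))
      (t * (∑' j, |h j * s j|) ^ 2) :=
    (hasSum_mul_self (g := fun j => |h j * s j|) (fun j => abs_nonneg _) hhs).mul_left t
  rw [← h3.tsum_eq, ← Real.norm_eq_abs]
  refine tsum_of_norm_bounded h4 fun p => ?_
  rw [Real.norm_eq_abs, abs_mul]
  calc _ ≤ |h p.1 * h p.2| * (t * |s p.1 * s p.2|) := by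
        refine mul_le_mul_of_nonneg_left ((hA p.1 p.2).trans ?_) (abs_nonneg _)
        exact mul_le_mul_of_nonneg_left (le_abs_self _) ht
    _ = _ := by simp only [abs_mul]; ring

/-- The oracle inequality for kernel ridge regression on the event that the empirical covariances
and the empirical noise coefficients are controlled with weights `L`. -/
theorem errCoef_bound {lam c B V σ κ Bθ : ℝ} {L : ℕ → ℝ} (hn : 0 < n) (hlam : 0 < lam)
    (hκ : 0 ≤ κ) (hμ : ∀ j, 0 < μ j) (hμs : Summable μ) (hμc : ∀ j, μ j ≤ c)
    (hψ : ∀ j l, |ψ j l| ≤ B) (hθs : Summable fun j => |θ j|)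
    (hθ : HasSum (fun j => θ j ^ 2 / μ j) Bθ) (hL : ∀ j, 0 ≤ L j)
    (hV : HasSum (fun j => μ j / (μ j + lam) * L j) V)
    (hG : ∀ l l', HasSum (fun j => μ j * ψ j l * ψ j l') (G l l'))
    (hf : ∀ l, HasSum (fun j => θ j * ψ j l) (f l))
    (ha : ∀ l, (∑ l', G l l' * a l') + n * lam * a l = f l + ε l)
    (hZ : ∀ j, |∑ l, ε l * ψ j l| ≤ Real.sqrt (4 * σ ^ 2 * n * L j))
    (hA : ∀ i j, |∑ l, (ψ i l * ψ j l - if i = j then 1 else 0)| ≤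
      Real.sqrt (8 * n * (L i * L j)))
    (hcoer : κ ≤ 1 - V * Real.sqrt (8 / n) ∨ κ ≤ lam / (c + lam)) :
    Summable (fun j => errCoef ψ μ θ a j ^ 2 * (1 + lam / μ j)) ∧
      κ ^ 2 * ∑' j, errCoef ψ μ θ a j ^ 2 * (1 + lam / μ j) ≤
        2 * (4 * σ ^ 2 * V / n + lam * Bθ) := by
  have hn0 : (0 : ℝ) < n := by exact_mod_cast hn
  set h := errCoef ψ μ θ a with hh
  have hQ : Summable fun j => h j ^ 2 / μ j := summable_errCoef_sq_div hμ hμs hψ hθ.summable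
  have hS : Summable fun j => h j ^ 2 := by
    refine Summable.of_nonneg_of_le (fun j => sq_nonneg _) (fun j => ?_) (hQ.mul_left c)
    rw [mul_div_assoc', le_div_iff₀ (hμ j)]
    nlinarith [hμc j, sq_nonneg (h j)]
  have hUsum : HasSum (fun j => h j ^ 2 * (1 + lam / μ j))
      ((∑' j, h j ^ 2) + lam * ∑' j, h j ^ 2 / μ j) := by
    refine (hS.hasSum.add (hQ.hasSum.mul_left lam)).congr_fun fun j => ?_
    ring
  refine ⟨hUsum.summable, ?_⟩
  set Q := ∑' j, h j ^ 2 / μ j with hQdef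
  set S := ∑' j, h j ^ 2 with hSdef
  set U := ∑' j, h j ^ 2 * (1 + lam / μ j) with hUdef
  have hUeq : U = S + lam * Q := hUsum.tsum_eq
  have hQ0 : 0 ≤ Q := tsum_nonneg fun j => div_nonneg (sq_nonneg _) (hμ j).le
  have hS0 : 0 ≤ S := tsum_nonneg fun j => sq_nonneg _
  have hU0 : 0 ≤ U := by rw [hUeq]; positivity
  have hV0 : 0 ≤ V := hV.nonneg fun j => mul_nonneg
    (div_nonneg (hμ j).le (by linarith [hμ j])) (hL j)
  have hBθ0 : 0 ≤ Bθ := hθ.nonneg fun j => div_nonneg (sq_nonneg _) (hμ j).le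
  -- the weighted absolute sum of the coefficients
  have hCS : Summable (fun j => |h j * Real.sqrt (L j)|) ∧
      ∑' j, |h j * Real.sqrt (L j)| ≤ Real.sqrt (U * V) := by
    have h1 : ∀ j, Real.sqrt (h j ^ 2 * (1 + lam / μ j)) ^ 2 = h j ^ 2 * (1 + lam / μ j) :=
      fun j => Real.sq_sqrt (mul_nonneg (sq_nonneg _) (by have := hμ j; positivity))
    have h2 : ∀ j, Real.sqrt (μ j / (μ j + lam) * L j) ^ 2 = μ j / (μ j + lam) * L j :=
      fun j => Real.sq_sqrt (mul_nonneg (by have := hμ j; positivity) (hL j))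
    -- The factors `1 + lam / μ j` and `μ j / (μ j + lam)` are reciprocal, so Cauchy–Schwarz
    -- separates the error energy `U` from `V`.
    have h3 : ∀ j, |Real.sqrt (h j ^ 2 * (1 + lam / μ j)) *
        Real.sqrt (μ j / (μ j + lam) * L j)| = |h j * Real.sqrt (L j)| := by
      intro j
      have hj := hμ j
      rw [← Real.sqrt_mul (by positivity), abs_of_nonneg (Real.sqrt_nonneg _), abs_mul,
        abs_of_nonneg (Real.sqrt_nonneg (L j)), ← Real.sqrt_sq_eq_abs, ← Real.sqrt_mul (sq_nonneg _)]
      congr 1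
      field_simp
    have := summable_abs_mul_and_sq_tsum_le
      (a := fun j => Real.sqrt (h j ^ 2 * (1 + lam / μ j)))
      (b := fun j => Real.sqrt (μ j / (μ j + lam) * L j))
      (by simpa only [h1] using hUsum.summable) (by simpa only [h2] using hV.summable)
    simpa only [h1, h2, h3, hV.tsum_eq] using this
  obtain ⟨hWs, hW⟩ := hCS
  have hW0 : 0 ≤ ∑' j, |h j * Real.sqrt (L j)| := tsum_nonneg fun j => abs_nonneg _
  -- the cross term with the regression function
  have hPs : Summable (fun j => |h j * θ j / μ j|) ∧
      ∑' j, |h j * θ j / μ j| ≤ Real.sqrt (Q * Bθ) := by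
    have h1 : ∀ (x : ℕ → ℝ) j, (x j / Real.sqrt (μ j)) ^ 2 = x j ^ 2 / μ j := fun x j => by
      rw [div_pow, Real.sq_sqrt (hμ j).le]
    have h3 : ∀ j, h j / Real.sqrt (μ j) * (θ j / Real.sqrt (μ j)) = h j * θ j / μ j := fun j => by
      rw [div_mul_div_comm, Real.mul_self_sqrt (hμ j).le]
    have := summable_abs_mul_and_sq_tsum_le
      (a := fun j => h j / Real.sqrt (μ j)) (b := fun j => θ j / Real.sqrt (μ j))
      (by simpa only [h1] using hQ) (by simpa only [h1] using hθ.summable)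
    simpa only [h1, h3, hθ.tsum_eq] using this
  obtain ⟨hPa, hP⟩ := hPs
  have hid := errCoef_energy_identity hμ hG hf ha hQ hPa.of_abs
  have hHs := hasSum_errCoef hG hf ha
  set H : Fin n → ℝ := fun l => ε l - n * lam * a l with hHdef
  -- the noise term
  have hnoise : ∑ l, ε l * H l ≤ Real.sqrt (4 * σ ^ 2 * n) * Real.sqrt (U * V) := by
    have h1 : HasSum (fun j => h j * ∑ l, ε l * ψ j l) (∑ l, ε l * H l) := by
      refine (hasSum_sum fun l (_ : l ∈ Finset.univ) => (hHs l).mul_left (ε l)).congr_fun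
        fun j => ?_
      rw [Finset.mul_sum]
      exact Finset.sum_congr rfl fun l _ => by ring
    have h2 : ∀ j, h j * ∑ l, ε l * ψ j l ≤
        Real.sqrt (4 * σ ^ 2 * n) * |h j * Real.sqrt (L j)| := by
      intro j
      calc _ ≤ |h j| * |∑ l, ε l * ψ j l| := by rw [← abs_mul]; exact le_abs_self _
        _ ≤ |h j| * Real.sqrt (4 * σ ^ 2 * n * L j) := by gcongr; exact hZ j
        _ = _ := by
          rw [Real.sqrt_mul (by positivity), abs_mul, abs_of_nonneg (Real.sqrt_nonneg (L j))]
          ring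
    refine (hasSum_le h2 h1 (hWs.hasSum.mul_left _)).trans ?_
    gcongr
  have hcross : -∑' j, h j * θ j / μ j ≤ Real.sqrt (Q * Bθ) := by
    refine (neg_le_abs _).trans ?_
    refine le_trans ?_ hP
    rw [← Real.norm_eq_abs]
    exact norm_tsum_le_tsum_norm hPa
  -- coercivity
  have hlow : n * (κ * U) ≤ ∑ l, H l ^ 2 + n * lam * Q := by
    -- Either the empirical norm is comparable to the `L²` norm, or it is discarded and the penalty
    -- dominates through `S ≤ c * Q`.
    rcases hcoer with hκ1 | hκ2
    · have hhabs : Summable fun j => |h j| := by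
        have h1 : Summable fun j => |μ j * ∑ l, a l * ψ j l| := by
          refine Summable.of_nonneg_of_le (fun j => abs_nonneg _) (fun j => ?_)
            (hμs.mul_right (∑ l, |a l| * B))
          rw [abs_mul, abs_of_pos (hμ j)]
          refine mul_le_mul_of_nonneg_left ?_ (hμ j).le
          exact (Finset.abs_sum_le_sum_abs _ _).trans (Finset.sum_le_sum fun l _ => by
            rw [abs_mul]; exact mul_le_mul_of_nonneg_left (hψ j l) (abs_nonneg _))
        exact Summable.of_nonneg_of_le (fun j => abs_nonneg _)
          (fun j => abs_sub _ _) (h1.add hθs)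
      have hq := abs_sum_sq_sub_le (t := Real.sqrt (8 * n)) (s := fun j => Real.sqrt (L j)) hHs hWs
        hhabs (fun i j => by
          refine (hA i j).trans (le_of_eq ?_)
          rw [Real.sqrt_mul (by positivity), Real.sqrt_mul (hL i)]) hψ (Real.sqrt_nonneg _)
      have h1 : (∑' j, |h j * Real.sqrt (L j)|) ^ 2 ≤ U * V := by
        have := pow_le_pow_left₀ hW0 hW 2
        rwa [Real.sq_sqrt (by positivity)] at this
      have h2 : Real.sqrt (8 * n) * (∑' j, |h j * Real.sqrt (L j)|) ^ 2 ≤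
          Real.sqrt (8 * n) * (U * V) := by gcongr
      have h3 : Real.sqrt (8 * n) = n * Real.sqrt (8 / n) := by
        have : (8 : ℝ) * n = n ^ 2 * (8 / n) := by field_simp
        rw [this, Real.sqrt_mul (sq_nonneg _), Real.sqrt_sq hn0.le]
      have h4 := (abs_le.1 hq).1
      have h5 : κ * U ≤ (1 - V * Real.sqrt (8 / n)) * U := by gcongr
      have h6 : n * (κ * U) ≤ n * ((1 - V * Real.sqrt (8 / n)) * U) := by gcongr
      rw [h3] at h2 h4
      have h7 : (n : ℝ) * U = n * S + n * lam * Q := by rw [hUeq]; ring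
      nlinarith
    · have hc : 0 < c := (hμ 0).trans_le (hμc 0)
      have h1 : S ≤ c * Q := by
        rw [hSdef, hQdef, ← tsum_mul_left]
        refine hS.tsum_le_tsum (fun j => ?_) (hQ.mul_left c)
        rw [mul_div_assoc', le_div_iff₀ (hμ j)]
        nlinarith [hμc j, sq_nonneg (h j)]
      have h2 : κ * U ≤ lam * Q := by
        calc κ * U ≤ lam / (c + lam) * ((c + lam) * Q) := by
              have : U ≤ (c + lam) * Q := by rw [hUeq]; linarith
              gcongr
          _ = lam * Q := by field_simp
      have h3 : 0 ≤ ∑ l, H l ^ 2 := Finset.sum_nonneg fun l _ => sq_nonneg _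
      have h4 : n * (κ * U) ≤ n * (lam * Q) := by gcongr
      linarith
  -- conclusion
  have hmain : κ * U ≤ Real.sqrt U * (Real.sqrt (4 * σ ^ 2 * V / n) + Real.sqrt (lam * Bθ)) := by
    have h1 : Real.sqrt (4 * σ ^ 2 * n) * Real.sqrt (U * V) =
        n * (Real.sqrt U * Real.sqrt (4 * σ ^ 2 * V / n)) := by
      rw [← Real.sqrt_mul (by positivity), ← Real.sqrt_mul (by positivity)]
      have : 4 * σ ^ 2 * n * (U * V) = (n : ℝ) ^ 2 * (U * (4 * σ ^ 2 * V / n)) := by field_simp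
      rw [this, Real.sqrt_mul (sq_nonneg _), Real.sqrt_sq hn0.le]
    have h2 : lam * Real.sqrt (Q * Bθ) ≤ Real.sqrt U * Real.sqrt (lam * Bθ) := by
      nth_rw 1 [← Real.sqrt_sq hlam.le]
      rw [← Real.sqrt_mul (by positivity), ← Real.sqrt_mul (by positivity)]
      apply Real.sqrt_le_sqrt
      have : lam * Q ≤ U := by rw [hUeq]; linarith
      calc lam ^ 2 * (Q * Bθ) = (lam * Q) * (lam * Bθ) := by ring
        _ ≤ _ := by gcongr
    have h3 : n * (κ * U) ≤ n * (Real.sqrt U *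
        (Real.sqrt (4 * σ ^ 2 * V / n) + Real.sqrt (lam * Bθ))) := by
      have h4 : n * lam * (-∑' j, h j * θ j / μ j) ≤ n * lam * Real.sqrt (Q * Bθ) := by gcongr
      have h5 : (n : ℝ) * (lam * Real.sqrt (Q * Bθ)) ≤
        n * (Real.sqrt U * Real.sqrt (lam * Bθ)) := by gcongr
      linarith
    exact le_of_mul_le_mul_left h3 hn0
  -- `hmain` is quadratic in `√U`; one factor can be cancelled unless `U = 0`, where the claim is
  -- trivial.
  rcases hU0.eq_or_lt with hU | hU
  · rw [← hU, mul_zero]; positivity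
  · have hsU : 0 < Real.sqrt U := Real.sqrt_pos.2 hU
    have h1 : κ * Real.sqrt U ≤ Real.sqrt (4 * σ ^ 2 * V / n) + Real.sqrt (lam * Bθ) := by
      refine le_of_mul_le_mul_left ?_ hsU
      calc Real.sqrt U * (κ * Real.sqrt U) = κ * (Real.sqrt U * Real.sqrt U) := by ring
        _ = κ * U := by rw [Real.mul_self_sqrt hU.le]
        _ ≤ _ := hmain
    have h2 := pow_le_pow_left₀ (by positivity) h1 2
    rw [mul_pow, Real.sq_sqrt hU.le] at h2
    refine h2.trans (add_sq_le.trans ?_)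
    rw [Real.sq_sqrt (by positivity), Real.sq_sqrt (by positivity)]

end RidgeRegression

/-! ### Concentration of noise coefficients and empirical covariances. -/

section Observation

variable {g : ℝ → ℝ} {σ : ℝ≥0}

theorem measurable_obs (hg : Measurable g) :
    Measurable (fun p : ℝ × ℝ => (p.1, g p.1 + p.2)) :=
  measurable_fst.prodMk ((hg.comp measurable_fst).add measurable_snd)

theorem isProbabilityMeasure_obsLaw (hg : Measurable g) : IsProbabilityMeasure (obsLaw g σ) :=
  Measure.isProbabilityMeasure_map (measurable_obs hg).aemeasurable

theorem map_fst_obsLaw (hg : Measurable g) : (obsLaw g σ).map Prod.fst = unifLaw := by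
  rw [obsLaw, Measure.map_map measurable_fst (measurable_obs hg)]
  exact Measure.map_fst_prod.trans (by simp)

theorem ae_fst_mem_prod :
    ∀ᵐ p ∂(unifLaw.prod (gaussianReal 0 (σ ^ 2))), p.1 ∈ Icc (0 : ℝ) 1 :=
  Measure.quasiMeasurePreserving_fst.ae ae_mem_Icc_unifLaw

/-- The covariate lies in `[0,1]` almost surely. This allows replacing a regression function that is
regular only on `[0,1]` by a globally measurable one. -/
theorem obsLaw_congr {f : ℝ → ℝ} (hfg : EqOn f g (Icc 0 1)) : obsLaw f σ = obsLaw g σ := by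
  refine Measure.map_congr ?_
  filter_upwards [ae_fst_mem_prod] with p hp
  simp [hfg hp]

theorem ae_fst_mem_obsLaw (hg : Measurable g) : ∀ᵐ p ∂(obsLaw g σ), p.1 ∈ Icc (0 : ℝ) 1 := by
  refine ae_of_ae_map measurable_fst.aemeasurable (p := fun x => x ∈ Icc (0 : ℝ) 1) ?_
  rw [map_fst_obsLaw hg]
  exact ae_mem_Icc_unifLaw

/-- Conditionally on the covariate the product is Gaussian with variance `σ² φ(x)²`; its moment
generating function is bounded uniformly in `x` and then integrated. -/
theorem hasSubgaussianMGF_noise_prod {φ : ℝ → ℝ} (hφ : Measurable φ) {b : ℝ≥0}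
    (hb : ∀ x, φ x ^ 2 ≤ b) :
    HasSubgaussianMGF (fun p : ℝ × ℝ => p.2 * φ p.1) (σ ^ 2 * b)
      (unifLaw.prod (gaussianReal 0 (σ ^ 2))) := by
  have hinner : ∀ t x : ℝ, ∫ y, Real.exp (t * (y * φ x)) ∂gaussianReal 0 (σ ^ 2) =
      Real.exp (σ ^ 2 * (t * φ x) ^ 2 / 2) := by
    intro t x
    have := congrFun (mgf_fun_id_gaussianReal (μ := 0) (v := σ ^ 2)) (t * φ x)
    simp only [mgf] at this
    simp only [zero_mul, zero_add, NNReal.coe_pow] at this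
    rw [← this]
    congr 1
    ext y
    ring_nf
  have hmeas : ∀ t : ℝ, Measurable fun p : ℝ × ℝ => Real.exp (t * (p.2 * φ p.1)) := fun t =>
    ((measurable_snd.mul (hφ.comp measurable_fst)).const_mul t).exp
  have hle : ∀ t x : ℝ, Real.exp (σ ^ 2 * (t * φ x) ^ 2 / 2) ≤
      Real.exp (((σ ^ 2 * b : ℝ≥0) : ℝ) * t ^ 2 / 2) := by
    intro t x
    rw [Real.exp_le_exp, mul_pow]
    push_cast
    have := mul_le_mul_of_nonneg_left (hb x) (mul_nonneg (sq_nonneg (σ : ℝ)) (sq_nonneg t))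
    linarith
  have hint : ∀ t : ℝ, Integrable (fun x => Real.exp (σ ^ 2 * (t * φ x) ^ 2 / 2)) unifLaw :=
    fun t => Integrable.of_bound (Measurable.aestronglyMeasurable (by fun_prop)) _
      (Filter.Eventually.of_forall fun x => by
        rw [Real.norm_eq_abs, abs_of_pos (Real.exp_pos _)]
        exact hle t x)
  have hI : ∀ t : ℝ, Integrable (fun p : ℝ × ℝ => Real.exp (t * (p.2 * φ p.1)))
      (unifLaw.prod (gaussianReal 0 (σ ^ 2))) := by
    intro t
    rw [integrable_prod_iff (hmeas t).aestronglyMeasurable]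
    constructor
    · refine Filter.Eventually.of_forall fun x => ?_
      refine (integrable_exp_mul_gaussianReal (μ := 0) (v := σ ^ 2) (t * φ x)).congr
        (Filter.Eventually.of_forall fun y => ?_)
      simp only
      ring_nf
    · simp only [Real.norm_eq_abs, Real.abs_exp, hinner]
      exact hint t
  refine ⟨hI, fun t => ?_⟩
  rw [mgf, integral_prod _ (hI t)]
  simp only [hinner]
  refine (integral_mono (hint t) (integrable_const _) (hle t)).trans ?_
  simp

theorem hasSubgaussianMGF_noise (hg : Measurable g) {φ : ℝ → ℝ} (hφ : Measurable φ) {b : ℝ≥0}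
    (hb : ∀ x, φ x ^ 2 ≤ b) :
    HasSubgaussianMGF (fun p : ℝ × ℝ => (p.2 - g p.1) * φ p.1) (σ ^ 2 * b) (obsLaw g σ) := by
  have hm : Measurable fun p : ℝ × ℝ => (p.2 - g p.1) * φ p.1 :=
    (measurable_snd.sub (hg.comp measurable_fst)).mul (hφ.comp measurable_fst)
  refine (hasSubgaussianMGF_noise_prod hφ hb).congr_identDistrib ⟨?_, hm.aemeasurable, ?_⟩
  · exact (measurable_snd.mul (hφ.comp measurable_fst)).aemeasurable
  · rw [obsLaw, Measure.map_map hm (measurable_obs hg)]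
    congr 1
    ext p
    simp

theorem hasSubgaussianMGF_trigBasis_mul (hg : Measurable g) {i j : ℕ} (hi : 1 ≤ i) (hj : 1 ≤ j) :
    HasSubgaussianMGF
      (fun p : ℝ × ℝ => trigBasis i p.1 * trigBasis j p.1 - if i = j then 1 else 0) 4
      (obsLaw g σ) := by
  have := isProbabilityMeasure_obsLaw (σ := σ) hg
  have hc : Measurable fun x => trigBasis i x * trigBasis j x :=
    ((continuous_trigBasis i).mul (continuous_trigBasis j)).measurable
  have hmean : ∫ p, trigBasis i p.1 * trigBasis j p.1 ∂(obsLaw g σ) = if i = j then 1 else 0 := by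
    rw [← integral_trigBasis_mul hi hj, ← map_fst_obsLaw (σ := σ) hg,
      integral_map measurable_fst.aemeasurable hc.aestronglyMeasurable]
  have h := hasSubgaussianMGF_of_mem_Icc (μ := obsLaw g σ) (a := -2) (b := 2)
    (X := fun p : ℝ × ℝ => trigBasis i p.1 * trigBasis j p.1)
    (hc.comp measurable_fst).aemeasurable (Filter.Eventually.of_forall fun p => by
      have h1 := mul_le_mul (abs_trigBasis_le i p.1) (abs_trigBasis_le j p.1) (abs_nonneg _)
        (Real.sqrt_nonneg 2)
      rw [← abs_mul, Real.mul_self_sqrt (by norm_num)] at h1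
      exact abs_le.1 h1)
  rw [hmean] at h
  -- Hoeffding's parameter is the squared half-length of `[-2, 2]`, namely `4`.
  convert h using 1
  rw [← NNReal.coe_inj]
  push_cast
  norm_num

end Observation

section Sample

variable {P : Measure (ℝ × ℝ)} [IsProbabilityMeasure P] {n : ℕ}

theorem measure_abs_sum_ge_le {X : ℝ × ℝ → ℝ} {c : ℝ≥0} (hX : HasSubgaussianMGF X c P) {t : ℝ}
    (ht : 0 ≤ t) :
    (Measure.pi fun _ : Fin n => P) {D | t ≤ |∑ l, X (D l)|} ≤
      ENNReal.ofReal (2 * Real.exp (-t ^ 2 / (2 * (n * c)))) := by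
  have key : ∀ {Z : ℝ × ℝ → ℝ}, HasSubgaussianMGF Z c P →
      (Measure.pi fun _ : Fin n => P).real {D | t ≤ ∑ l, Z (D l)} ≤
        Real.exp (-t ^ 2 / (2 * (n * c))) := by
    intro Z hZ
    have hind : iIndepFun (fun (l : Fin n) (D : Fin n → ℝ × ℝ) => Z (D l))
        (Measure.pi fun _ : Fin n => P) := iIndepFun_pi (X := fun _ => Z) fun _ => hZ.aemeasurable
    have := HasSubgaussianMGF.measure_sum_ge_le_of_iIndepFun hind (c := fun _ => c)
      (s := Finset.univ) (fun l _ => HasSubgaussianMGF.of_map (Y := fun D : Fin n → ℝ × ℝ => D l) (X := Z)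
        (measurable_pi_apply l).aemeasurable
        (by rwa [(measurePreserving_eval (fun _ : Fin n => P) l).map_eq])) ht
    simpa using this
  have h1 := key hX
  have h2 := key hX.neg
  have hsub : {D : Fin n → ℝ × ℝ | t ≤ |∑ l, X (D l)|} ⊆
      {D | t ≤ ∑ l, X (D l)} ∪ {D | t ≤ ∑ l, (-X) (D l)} := by
    intro D hD
    rcases le_abs.1 (show t ≤ |∑ l, X (D l)| from hD) with h | h
    · exact Or.inl h
    · exact Or.inr (by simpa using h)
  rw [← ofReal_measureReal]
  refine ENNReal.ofReal_le_ofReal ?_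
  have := (measureReal_mono hsub).trans (measureReal_union_le (μ := Measure.pi fun _ : Fin n => P)
    {D | t ≤ ∑ l, X (D l)} {D | t ≤ ∑ l, (-X) (D l)})
  linarith

end Sample

theorem hasSum_inv_sq_succ : HasSum (fun j : ℕ => (((j + 1 : ℕ) : ℝ) ^ 2)⁻¹) (Real.pi ^ 2 / 6) := by
  have := (hasSum_nat_add_iff' 1).2 hasSum_zeta_two
  simpa using this

theorem exp_neg_level {n : ℕ} (hn : 2 ≤ n) (j : ℕ) :
    Real.exp (-level n j) = ((n : ℝ) ^ 20)⁻¹ * (((j + 1 : ℕ) : ℝ) ^ 2)⁻¹ := by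
  have h1 : level n j = Real.log ((n : ℝ) ^ 20 * ((j + 1 : ℕ) : ℝ) ^ 2) := by
    rw [Real.log_mul (by positivity) (by positivity), Real.log_pow, Real.log_pow, level]
    norm_num
  rw [h1, Real.exp_neg, Real.exp_log (by positivity), mul_inv]

theorem measure_exists_le_of_le_ofReal {Ω ι : Type*} [MeasurableSpace Ω] [Countable ι]
    {P : Measure Ω} {A : ι → Set Ω} {b : ι → ℝ} {B : ℝ} (hb : ∀ i, 0 ≤ b i) (hB : HasSum b B)
    (hA : ∀ i, P (A i) ≤ ENNReal.ofReal (b i)) : P (⋃ i, A i) ≤ ENNReal.ofReal B := by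
  rw [← hB.tsum_eq, ENNReal.ofReal_tsum_of_nonneg hb hB.summable]
  exact (measure_iUnion_le _).trans (ENNReal.tsum_le_tsum hA)

/-- With high probability, all empirical noise coefficients and all empirical covariances of the
Fourier basis deviate little from their means. -/
theorem exists_good_event {g : ℝ → ℝ} (hg : Measurable g) {σ : ℝ≥0} (hσ : 0 < σ) {n : ℕ}
    (hn : 2 ≤ n) :
    ∃ E : Set (Fin n → ℝ × ℝ), 1 - 1 / (n : ℝ) ^ 10 ≤ (dataLaw g σ n).real E ∧
      ∀ D ∈ E, (∀ l, (D l).1 ∈ Icc (0 : ℝ) 1) ∧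
        (∀ j, |∑ l, ((D l).2 - g (D l).1) * trigBasis (j + 1) (D l).1| ≤
          Real.sqrt (4 * (σ : ℝ) ^ 2 * n * level n j)) ∧
        ∀ i j, |∑ l, (trigBasis (i + 1) (D l).1 * trigBasis (j + 1) (D l).1 -
          if i = j then 1 else 0)| ≤ Real.sqrt (8 * n * (level n i * level n j)) := by
  have hP := isProbabilityMeasure_obsLaw (σ := σ) hg
  have hn0 : (0 : ℝ) < n := by positivity
  have hσ0 : (0 : ℝ) < σ := hσ
  have hlev := fun j => level_pos hn j
  set P : Measure (Fin n → ℝ × ℝ) := dataLaw g σ n with hPdef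
  have hPP : IsProbabilityMeasure P := by rw [hPdef, dataLaw]; infer_instance
  set A0 : Set (Fin n → ℝ × ℝ) := {D | ¬ ∀ l, (D l).1 ∈ Icc (0 : ℝ) 1} with hA0
  set A1 : ℕ → Set (Fin n → ℝ × ℝ) := fun j => {D | Real.sqrt (4 * (σ : ℝ) ^ 2 * n * level n j) ≤
    |∑ l, ((D l).2 - g (D l).1) * trigBasis (j + 1) (D l).1|} with hA1
  set A2 : ℕ × ℕ → Set (Fin n → ℝ × ℝ) := fun p =>
    {D | Real.sqrt (8 * n * (level n p.1 * level n p.2)) ≤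
      |∑ l, (trigBasis (p.1 + 1) (D l).1 * trigBasis (p.2 + 1) (D l).1 -
        if p.1 = p.2 then 1 else 0)|} with hA2
  have h0 : P A0 = 0 := by
    have : ∀ᵐ D ∂P, ∀ l, (D l).1 ∈ Icc (0 : ℝ) 1 := by
      refine ae_all_iff.2 fun l => ?_
      exact (Measure.quasiMeasurePreserving_eval (fun _ : Fin n => obsLaw g σ) l).ae
        (ae_fst_mem_obsLaw hg)
    exact this
  set z : ℝ := Real.pi ^ 2 / 6 with hz
  have hz0 : 0 ≤ z := by positivity
  have hz2 : z ≤ 2 := by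
    have h1 := Real.pi_lt_d2
    have h2 := Real.pi_pos
    rw [hz]; nlinarith
  have h1 : P (⋃ j, A1 j) ≤ ENNReal.ofReal (2 * ((n : ℝ) ^ 20)⁻¹ * z) := by
    refine measure_exists_le_of_le_ofReal (fun j => by positivity)
      (hasSum_inv_sq_succ.mul_left (2 * ((n : ℝ) ^ 20)⁻¹)) fun j => ?_
    have hX := hasSubgaussianMGF_noise (σ := σ) hg (φ := trigBasis (j + 1))
      (continuous_trigBasis (j + 1)).measurable (b := 2) (fun x => by
        have := abs_trigBasis_le (j + 1) x
        rw [← sq_abs]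
        calc _ ≤ Real.sqrt 2 ^ 2 := by gcongr
          _ = _ := by simp)
    refine (measure_abs_sum_ge_le (n := n) hX (Real.sqrt_nonneg _)).trans (le_of_eq ?_)
    congr 1
    have hl := hlev j
    rw [Real.sq_sqrt (by positivity), mul_assoc 2 _ (_ ^ 2)⁻¹, ← exp_neg_level hn]
    congr 2
    push_cast
    field_simp
    ring
  have h2 : P (⋃ p, A2 p) ≤ ENNReal.ofReal (2 * (((n : ℝ) ^ 20)⁻¹ * ((n : ℝ) ^ 20)⁻¹) * (z * z)) := by
    have hs := hasSum_inv_sq_succ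
    have hs2 : HasSum (fun p : ℕ × ℕ => (((p.1 + 1 : ℕ) : ℝ) ^ 2)⁻¹ * (((p.2 + 1 : ℕ) : ℝ) ^ 2)⁻¹)
        (z * z) := hs.mul hs (hs.summable.mul_of_nonneg hs.summable (fun j => by positivity)
          (fun j => by positivity))
    refine measure_exists_le_of_le_ofReal (fun p => by positivity)
      (hs2.mul_left (2 * (((n : ℝ) ^ 20)⁻¹ * ((n : ℝ) ^ 20)⁻¹))) fun p => ?_
    have hX := hasSubgaussianMGF_trigBasis_mul (σ := σ) hg (i := p.1 + 1) (j := p.2 + 1)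
      (by omega) (by omega)
    simp only [add_left_inj] at hX
    refine (measure_abs_sum_ge_le (n := n) hX (Real.sqrt_nonneg _)).trans ?_
    refine ENNReal.ofReal_le_ofReal ?_
    have hl := hlev p.1
    have hl2 := hlev p.2
    rw [Real.sq_sqrt (by positivity)]
    have he : 2 * (((n : ℝ) ^ 20)⁻¹ * ((n : ℝ) ^ 20)⁻¹) *
        ((((p.1 + 1 : ℕ) : ℝ) ^ 2)⁻¹ * (((p.2 + 1 : ℕ) : ℝ) ^ 2)⁻¹) =
        2 * Real.exp (-level n p.1 + -level n p.2) := by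
      rw [Real.exp_add, exp_neg_level hn, exp_neg_level hn]; ring
    rw [he]
    have : -(8 * (n : ℝ) * (level n p.1 * level n p.2)) / (2 * (n * ((4 : ℝ≥0) : ℝ))) =
        -(level n p.1 * level n p.2) := by
      push_cast
      field_simp
      ring
    rw [this]
    gcongr
    -- Both levels are at least `10`, so their product exceeds their sum; the tail then factorises
    -- and is summable over pairs.
    nlinarith
  set Bad : Set (Fin n → ℝ × ℝ) := A0 ∪ ((⋃ j, A1 j) ∪ ⋃ p, A2 p) with hBad
  -- The union bounds total at most `(4 + 8) n⁻²⁰`; the spare `n⁻¹⁰ ≤ 2⁻¹⁰` absorbs the constant.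
  have hn20 : ((n : ℝ) ^ 20)⁻¹ ≤ 1 / (n : ℝ) ^ 10 * (1 / 1024) := by
    have h2n : (2 : ℝ) ≤ n := by exact_mod_cast hn
    have : (2 : ℝ) ^ 10 ≤ (n : ℝ) ^ 10 := by gcongr
    rw [one_div_mul_one_div, ← one_div]
    refine one_div_le_one_div_of_le (by positivity) ?_
    calc (n : ℝ) ^ 10 * 1024 ≤ (n : ℝ) ^ 10 * (n : ℝ) ^ 10 := by gcongr; linarith
      _ = _ := by ring
  have hx1 : ((n : ℝ) ^ 20)⁻¹ ≤ 1 := inv_le_one_of_one_le₀ (one_le_pow₀ (by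
    have : 1 ≤ n := by omega
    exact_mod_cast this))
  have hBadle : P.real Bad ≤ 1 / (n : ℝ) ^ 10 := by
    have hr1 : P.real (⋃ j, A1 j) ≤ 2 * ((n : ℝ) ^ 20)⁻¹ * z :=
      ENNReal.toReal_le_of_le_ofReal (by positivity) h1
    have hr2 : P.real (⋃ p, A2 p) ≤ 2 * (((n : ℝ) ^ 20)⁻¹ * ((n : ℝ) ^ 20)⁻¹) * (z * z) :=
      ENNReal.toReal_le_of_le_ofReal (by positivity) h2
    have hr0 : P.real A0 = 0 := by simp [Measure.real, h0]
    have hu := measureReal_union_le (μ := P) A0 ((⋃ j, A1 j) ∪ ⋃ p, A2 p)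
    have hu2 := measureReal_union_le (μ := P) (⋃ j, A1 j) (⋃ p, A2 p)
    have hx0 : 0 ≤ ((n : ℝ) ^ 20)⁻¹ := by positivity
    have hb1 : 2 * ((n : ℝ) ^ 20)⁻¹ * z ≤ 2 * ((n : ℝ) ^ 20)⁻¹ * 2 := by gcongr
    have hb2 : 2 * (((n : ℝ) ^ 20)⁻¹ * ((n : ℝ) ^ 20)⁻¹) * (z * z) ≤
        2 * (((n : ℝ) ^ 20)⁻¹ * 1) * (2 * 2) := by gcongr
    have : 0 ≤ 1 / (n : ℝ) ^ 10 := by positivity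
    rw [hBad]
    linarith
  refine ⟨Badᶜ, ?_, fun D hD => ?_⟩
  · have h3 := measureReal_union_le (μ := P) Bad Badᶜ
    rw [union_compl_self, probReal_univ] at h3
    linarith
  · simp only [hBad, compl_union, mem_inter_iff, mem_compl_iff, mem_iUnion, not_exists] at hD
    obtain ⟨hD0, hD1, hD2⟩ := hD
    refine ⟨not_not.1 hD0, fun j => ?_, fun i j => ?_⟩
    · exact (not_le.1 (hD1 j)).le
    · exact (not_le.1 (hD2 (i, j))).le

/-! ### From coefficient bounds to derivatives of the posterior mean. -/

theorem deriv01_eq_trigSeries {p : ℕ → ℝ} {F : ℝ → ℝ} {k : ℕ}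
    (hk : Summable fun j : ℕ => ((j + 1 : ℕ) : ℝ) ^ k * |p j|)
    (hF : ∀ x ∈ Icc (0 : ℝ) 1, HasSum (fun j => p j * trigBasis (j + 1) x) (F x)) :
    ContDiffOn ℝ k F (Icc 0 1) ∧
      ∀ x ∈ Icc (0 : ℝ) 1, deriv01 k F x = ∑' j, p j * trigDeriv k (j + 1) x := by
  have heq : EqOn F (fun x => ∑' j, p j * trigDeriv 0 (j + 1) x) (Icc 0 1) := fun x hx => by
    simp only [trigDeriv_zero]
    exact (hF x hx).tsum_eq.symm
  have hcd := contDiff_trigSeries hk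
  refine ⟨hcd.contDiffOn.congr heq, fun x hx => ?_⟩
  rw [deriv01, iteratedDerivWithin_congr heq hx,
    iteratedDerivWithin_eq_iteratedDeriv (uniqueDiffOn_Icc zero_lt_one) hcd.contDiffAt hx,
    iteratedDeriv_trigSeries hk le_rfl]

theorem eLpNorm_trigSeries_le {h : ℕ → ℝ} {k : ℕ}
    (hk : Summable fun j : ℕ => ((j + 1 : ℕ) : ℝ) ^ k * |h j|) {S : ℝ}
    (hS : HasSum (fun j => h j ^ 2 * (2 * (Real.pi * ((j + 1 : ℕ) : ℝ)) ^ (2 * k))) S) :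
    eLpNorm (fun x => ∑' j, h j * trigDeriv k (j + 1) x) 2 unifLaw ≤
      ENNReal.ofReal (Real.sqrt S) := by
  have hm : MemLp (fun x => ∑' j, h j * trigDeriv k (j + 1) x) 2 unifLaw :=
    MemLp.of_bound (continuous_trigSeries hk).aestronglyMeasurable _
      (Filter.Eventually.of_forall fun x => abs_trigSeries_le hk x)
  rw [hm.eLpNorm_eq_integral_rpow_norm (by norm_num) (by norm_num)]
  refine ENNReal.ofReal_le_ofReal ?_
  simp only [ENNReal.toReal_ofNat, Real.rpow_ofNat, Real.norm_eq_abs, sq_abs]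
  rw [← one_div, ← Real.sqrt_eq_rpow]
  exact Real.sqrt_le_sqrt (integral_trigSeries_sq_le hk hS)

/-- The quadratic form of `G` is `∑ μ j (∑ v l ψ j l)²`, hence nonnegative. Adding `m > 0` on the
diagonal makes the matrix invertible, so the formal inverse is a genuine one. -/
theorem ridge_solution {n : ℕ} {ψ : ℕ → Fin n → ℝ} {μ : ℕ → ℝ} {G : Matrix (Fin n) (Fin n) ℝ}
    {m : ℝ} (hμ : ∀ j, 0 < μ j) (hm : 0 < m)
    (hG : ∀ l l', HasSum (fun j => μ j * ψ j l * ψ j l') (G l l')) (Y : Fin n → ℝ) (l : Fin n) :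
    ∑ l', G l l' * ((G + m • (1 : Matrix (Fin n) (Fin n) ℝ))⁻¹ *ᵥ Y) l' +
      m * ((G + m • (1 : Matrix (Fin n) (Fin n) ℝ))⁻¹ *ᵥ Y) l = Y l := by
  set M := G + m • (1 : Matrix (Fin n) (Fin n) ℝ) with hM
  have hmul : ∀ (v : Fin n → ℝ) l, (M *ᵥ v) l = ∑ l', G l l' * v l' + m * v l := by
    intro v l
    rw [hM, Matrix.add_mulVec, Matrix.smul_mulVec, Matrix.one_mulVec]
    simp [Matrix.mulVec, dotProduct]
  have hdet : M.det ≠ 0 := by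
    intro h0
    obtain ⟨v, hv, hMv⟩ := Matrix.exists_mulVec_eq_zero_iff.2 h0
    have h1 : HasSum (fun j => μ j * (∑ l, v l * ψ j l) ^ 2) (∑ l, v l * ∑ l', G l l' * v l') := by
      have h2 : HasSum (fun j => ∑ l, v l * ∑ l', μ j * ψ j l * ψ j l' * v l')
          (∑ l, v l * ∑ l', G l l' * v l') :=
        hasSum_sum fun l _ => (hasSum_sum fun l' _ => (hG l l').mul_right (v l')).mul_left (v l)
      refine h2.congr_fun fun j => ?_
      rw [sq, Finset.sum_mul_sum, Finset.mul_sum]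
      refine Finset.sum_congr rfl fun l _ => ?_
      rw [Finset.mul_sum, Finset.mul_sum]
      exact Finset.sum_congr rfl fun l' _ => by ring
    have h3 := h1.nonneg fun j => mul_nonneg (hμ j).le (sq_nonneg _)
    have h4 : ∑ l, v l * (M *ᵥ v) l = 0 := by simp [hMv]
    have h5 : ∑ l, v l * (M *ᵥ v) l = ∑ l, v l * (∑ l', G l l' * v l') + m * ∑ l, v l ^ 2 := by
      rw [Finset.mul_sum, ← Finset.sum_add_distrib]
      exact Finset.sum_congr rfl fun l _ => by rw [hmul]; ring
    have h6 : 0 ≤ ∑ l, v l ^ 2 := Finset.sum_nonneg fun l _ => sq_nonneg _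
    have h7 : ∑ l, v l ^ 2 = 0 := by nlinarith
    refine hv (funext fun l => ?_)
    have := (Finset.sum_eq_zero_iff_of_nonneg fun l _ => sq_nonneg (v l)).1 h7 l (Finset.mem_univ l)
    simpa using this
  rw [← hmul, Matrix.mulVec_mulVec, Matrix.mul_nonsing_inv _ (isUnit_iff_ne_zero.2 hdet),
    Matrix.one_mulVec]

theorem div_add_le_rpow {x lam p : ℝ} (hx : 0 < x) (hlam : 0 < lam) (hp0 : 0 ≤ p) (hp1 : p ≤ 1) :
    x / (x + lam) ≤ (x / lam) ^ p := by
  rcases le_total 1 (x / lam) with h | h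
  · exact (div_le_one_of_le₀ (by linarith) (by linarith)).trans (Real.one_le_rpow h hp0)
  · calc x / (x + lam) ≤ x / lam := by gcongr; linarith
      _ = (x / lam) ^ (1 : ℝ) := (Real.rpow_one _).symm
      _ ≤ _ := Real.rpow_le_rpow_of_exponent_ge (by positivity) h hp1

theorem sum_sq_le_of_hasSum {x : ℕ → ℝ} {T : ℝ} (hx : ∀ j, 0 ≤ x j) (hT : HasSum x T) :
    Summable (fun j => x j ^ 2) ∧ ∑' j, x j ^ 2 ≤ T ^ 2 := by
  have hle : ∀ j, x j ^ 2 ≤ T * x j := fun j => by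
    rw [sq]
    exact mul_le_mul_of_nonneg_right (le_hasSum hT j fun i _ => hx i) (hx j)
  have hs : Summable fun j => x j ^ 2 :=
    Summable.of_nonneg_of_le (fun j => sq_nonneg _) hle (hT.summable.mul_left T)
  refine ⟨hs, (hasSum_le hle hs.hasSum (hT.mul_left T)).trans (le_of_eq (sq T).symm)⟩

section PowerWeights

variable {α c lam : ℝ} {k : ℕ} {μ h : ℕ → ℝ}

/-- The shrinkage weight is at most `(μ/λ)^p` for every `p` in `[0,1]`; the choice `p = k/α` makes
the eigenvalue decay cancel the growth `i ^ (2k)` exactly. -/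
theorem weight_mul_pow_le (hα : 0 < α) (hkα : (k : ℝ) ≤ α) (hlam : 0 < lam)
    (hμ : ∀ j, 0 < μ j) (hμc : ∀ j, μ j ≤ c * ((j + 1 : ℕ) : ℝ) ^ (-(2 * α))) (j : ℕ) :
    μ j / (μ j + lam) * ((j + 1 : ℕ) : ℝ) ^ (2 * k) ≤ (c / lam) ^ (k / α) := by
  set i : ℝ := ((j + 1 : ℕ) : ℝ) with hi
  have hi0 : 0 < i := by positivity
  have hp0 : 0 ≤ k / α := by positivity
  have hc : 0 < c := by
    have := (hμ j).trans_le (hμc j)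
    exact pos_of_mul_pos_left this (by positivity)
  have h1 : μ j / lam ≤ c / lam * i ^ (-(2 * α)) := by
    rw [div_mul_eq_mul_div]
    gcongr
    exact hμc j
  calc _ ≤ (c / lam * i ^ (-(2 * α))) ^ (k / α) * i ^ (2 * k) := by
        gcongr
        refine (div_add_le_rpow (hμ j) hlam hp0 ((div_le_one hα).2 hkα)).trans ?_
        exact Real.rpow_le_rpow (div_nonneg (hμ j).le hlam.le) h1 hp0
    _ = (c / lam) ^ (k / α) := by
        rw [Real.mul_rpow (by positivity) (by positivity), ← Real.rpow_mul hi0.le, mul_assoc,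
          ← Real.rpow_natCast i (2 * k), ← Real.rpow_add hi0]
        have : -(2 * α) * (k / α) + ((2 * k : ℕ) : ℝ) = 0 := by
          push_cast; field_simp; ring
        rw [this, Real.rpow_zero, mul_one]

theorem exists_hasSum_sq_mul_pow_le (hα : 0 < α) (hkα : (k : ℝ) ≤ α) (hlam : 0 < lam)
    (hμ : ∀ j, 0 < μ j) (hμc : ∀ j, μ j ≤ c * ((j + 1 : ℕ) : ℝ) ^ (-(2 * α)))
    (hU : Summable fun j => h j ^ 2 * (1 + lam / μ j)) :
    ∃ S, HasSum (fun j => h j ^ 2 * (2 * (Real.pi * ((j + 1 : ℕ) : ℝ)) ^ (2 * k))) S ∧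
      S ≤ 2 * Real.pi ^ (2 * k) * (c / lam) ^ (k / α) * ∑' j, h j ^ 2 * (1 + lam / μ j) := by
  have hle : ∀ j, h j ^ 2 * (2 * (Real.pi * ((j + 1 : ℕ) : ℝ)) ^ (2 * k)) ≤
      2 * Real.pi ^ (2 * k) * (c / lam) ^ (k / α) * (h j ^ 2 * (1 + lam / μ j)) := by
    intro j
    have hj := hμ j
    have hw := weight_mul_pow_le hα hkα hlam hμ hμc j
    calc h j ^ 2 * (2 * (Real.pi * ((j + 1 : ℕ) : ℝ)) ^ (2 * k))
        = 2 * Real.pi ^ (2 * k) * (h j ^ 2 * (1 + lam / μ j)) *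
          (μ j / (μ j + lam) * ((j + 1 : ℕ) : ℝ) ^ (2 * k)) := by
          rw [mul_pow]; field_simp
      _ ≤ 2 * Real.pi ^ (2 * k) * (h j ^ 2 * (1 + lam / μ j)) * (c / lam) ^ (k / α) := by gcongr
      _ = _ := by ring
  have hs : Summable fun j => h j ^ 2 * (2 * (Real.pi * ((j + 1 : ℕ) : ℝ)) ^ (2 * k)) :=
    Summable.of_nonneg_of_le (fun j => by positivity) hle (hU.mul_left _)
  exact ⟨_, hs.hasSum, hasSum_le hle hs.hasSum (hU.hasSum.mul_left _)⟩

end PowerWeights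

/-! ### Uniform coercivity and assembly of the final rate. -/

theorem exists_coercivity_const {α : ℝ} (hα : 1 / 2 < α) {C c d : ℝ} (hc : 0 < c)
    (hd : 0 < d) :
    ∃ κ : ℝ, 0 < κ ∧ ∀ n : ℕ, 2 ≤ n → ∀ lam V : ℝ, d * rate α n ≤ lam →
      V ≤ C * (effDim α n * Real.log n) →
      κ ≤ 1 - V * Real.sqrt (8 / n) ∨ κ ≤ lam / (c + lam) := by
  have ht := (tendsto_effDim_mul_log_div_sqrt hα).const_mul C
  rw [mul_zero] at ht
  obtain ⟨N, hN⟩ := Filter.eventually_atTop.1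
    (ht.eventually (ge_mem_nhds (by norm_num : (0 : ℝ) < 1 / 2)))
  -- A lower bound for `rate α n` over `2 ≤ n ≤ N`, from `log n ≥ 1/2`; it keeps `lam` away from
  -- zero for small samples.
  set r : ℝ := (1 / 2 / ((N : ℝ) + 1)) ^ (2 * α / (2 * α + 1)) with hr
  have hr0 : 0 < r := by positivity
  refine ⟨min (1 / 2) (d * r / (c + d * r)), by positivity, fun n hn lam V hlam hV => ?_⟩
  rcases le_total N n with h | h
  · left
    refine (min_le_left _ _).trans ?_
    have h1 := hN n h
    have h2 : V * Real.sqrt (8 / n) ≤ C * (effDim α n * Real.log n) * Real.sqrt (8 / n) := by gcongr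
    linarith
  · right
    refine (min_le_right _ _).trans ?_
    have h1 : r ≤ rate α n := by
      refine Real.rpow_le_rpow (by positivity) ?_ (by positivity)
      have h2 : (n : ℝ) ≤ (N : ℝ) + 1 := by
        have : (n : ℝ) ≤ N := by exact_mod_cast h
        linarith
      have h3 : (0 : ℝ) < n := by positivity
      have := half_le_log hn
      gcongr
    have h4 : d * r ≤ lam := (by gcongr : d * r ≤ d * rate α n).trans hlam
    have h5 : 0 < d * r := by positivity
    rw [div_le_div_iff₀ (by positivity) (by linarith)]
    nlinarith

theorem rate_rpow_eq {α : ℝ} {k n : ℕ} (hα : 0 < α) (hn : 2 ≤ n) :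
    rate α n * (rate α n)⁻¹ ^ ((k : ℝ) / α) =
      ((Real.log n / n) ^ ((α - k) / (2 * α + 1))) ^ 2 := by
  have hL := log_div_pos hn
  rw [rate, ← Real.rpow_neg hL.le, ← Real.rpow_mul hL.le, ← Real.rpow_add hL,
    ← Real.rpow_natCast, ← Real.rpow_mul hL.le]
  congr 1
  push_cast
  field_simp
  ring

/-- The error bound for the posterior mean on a sample for which the empirical noise coefficients
and the empirical covariances are controlled. -/
theorem posteriorMean_error_bound {α : ℝ} {k n : ℕ} (hα : (k : ℝ) + 1 / 2 < α) {f₀ : ℝ → ℝ}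
    (hf₀ : ContinuousOn f₀ (Icc 0 1)) {R c₁ c lam σ V κ : ℝ} (hs : Summable (holderTerm α f₀))
    (hR : ∑' j, holderTerm α f₀ j ≤ R) (hc₁ : 0 < c₁) {K : ℝ → ℝ → ℝ} {μ : ℕ → ℝ}
    (hK : HasFourierEigenvalues K μ)
    (hμ₁ : ∀ j : ℕ, c₁ * ((j + 1 : ℕ) : ℝ) ^ (-(2 * α)) ≤ μ (j + 1))
    (hμc : ∀ j : ℕ, μ (j + 1) ≤ c * ((j + 1 : ℕ) : ℝ) ^ (-(2 * α)))
    (hn : 2 ≤ n) (hlam : 0 < lam) (hκ : 0 ≤ κ)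
    (hV : HasSum (fun j => μ (j + 1) / (μ (j + 1) + lam) * level n j) V)
    (hcoer : κ ≤ 1 - V * Real.sqrt (8 / n) ∨ κ ≤ lam / (c + lam)) {D : Fin n → ℝ × ℝ}
    (hX : ∀ l, (D l).1 ∈ Icc (0 : ℝ) 1)
    (hZ : ∀ j, |∑ l, ((D l).2 - f₀ (D l).1) * trigBasis (j + 1) (D l).1| ≤
      Real.sqrt (4 * σ ^ 2 * n * level n j))
    (hA : ∀ i j, |∑ l, (trigBasis (i + 1) (D l).1 * trigBasis (j + 1) (D l).1 -
      if i = j then 1 else 0)| ≤ Real.sqrt (8 * n * (level n i * level n j))) :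
    ContDiffOn ℝ k (posteriorMean K lam D) (Icc 0 1) ∧ ∃ U : ℝ,
      κ ^ 2 * U ≤ 2 * (4 * σ ^ 2 * V / n + lam * (R ^ 2 / c₁)) ∧
      eLpNorm (fun x => deriv01 k (posteriorMean K lam D) x - deriv01 k f₀ x) 2 unifLaw ≤
        ENNReal.ofReal (Real.sqrt (2 * Real.pi ^ (2 * k) * (c / lam) ^ (k / α) * U)) := by
  have hk0 : (0 : ℝ) ≤ k := by positivity
  have hα0 : 0 < α := by linarith
  have hn0 : (0 : ℝ) < n := by positivity
  have hi : ∀ j : ℕ, (1 : ℝ) ≤ ((j + 1 : ℕ) : ℝ) := fun j => by simp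
  have hμ0 : ∀ j, 0 < μ (j + 1) := fun j => lt_of_lt_of_le (by positivity) (hμ₁ j)
  have hc0 : 0 < c := by
    have h1 := (hμ0 0).trans_le (hμc 0)
    simpa using h1
  set θ : ℕ → ℝ := fun j => trigCoef f₀ (j + 1) with hθ
  set ψ : ℕ → Fin n → ℝ := fun j l => trigBasis (j + 1) (D l).1 with hψ
  set m : ℕ → ℝ := fun j => μ (j + 1) with hm
  set a : Fin n → ℝ := (gramMatrix K D + ((n : ℝ) * lam) • (1 : Matrix (Fin n) (Fin n) ℝ))⁻¹ *ᵥ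
    fun i => (D i).2 with ha
  -- summability of the eigenvalues and of the coefficients
  have hms : Summable fun j : ℕ => ((j + 1 : ℕ) : ℝ) ^ k * m j := by
    refine Summable.of_nonneg_of_le (fun j => mul_nonneg (by positivity) (hμ0 j).le) (fun j => ?_)
      ((summable_nat_succ_rpow_neg (by linarith : 1 < 2 * α - k)).mul_left c)
    calc ((j + 1 : ℕ) : ℝ) ^ k * m j
        ≤ ((j + 1 : ℕ) : ℝ) ^ k * (c * ((j + 1 : ℕ) : ℝ) ^ (-(2 * α))) := by
          gcongr; exact hμc j
      _ = c * (((j + 1 : ℕ) : ℝ) ^ (k : ℝ) * ((j + 1 : ℕ) : ℝ) ^ (-(2 * α))) := by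
          rw [Real.rpow_natCast]; ring
      _ = _ := by
          rw [← Real.rpow_add (by positivity)]
          congr 2; ring
  have hms0 : Summable m := by
    refine Summable.of_nonneg_of_le (fun j => (hμ0 j).le) (fun j => ?_) hms
    exact le_mul_of_one_le_left (hμ0 j).le (one_le_pow₀ (hi j))
  have hθk : Summable fun j : ℕ => ((j + 1 : ℕ) : ℝ) ^ k * |θ j| := by
    refine Summable.of_nonneg_of_le (fun j => by positivity) (fun j => ?_) hs
    rw [holderTerm, ← Real.rpow_natCast]
    gcongr
    · exact hi j
    · linarith
  have hθ0 : Summable fun j => |θ j| := by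
    simpa using summable_of_summable_pow_mul hθk (Nat.zero_le k)
  -- the source condition
  obtain ⟨hsq, hsqle⟩ := sum_sq_le_of_hasSum
    (fun j => mul_nonneg (Real.rpow_nonneg (Nat.cast_nonneg _) _) (abs_nonneg _)) hs.hasSum
  have hT0 : 0 ≤ ∑' j, holderTerm α f₀ j := tsum_nonneg fun j =>
    mul_nonneg (Real.rpow_nonneg (Nat.cast_nonneg _) _) (abs_nonneg _)
  -- The lower eigenvalue bound places `f₀` in the native space of the kernel: its weighted `ℓ¹`
  -- norm controls the weighted `ℓ²` norm.
  have hsrc : ∀ j, θ j ^ 2 / m j ≤ holderTerm α f₀ j ^ 2 / c₁ := by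
    intro j
    rw [div_le_div_iff₀ (hμ0 j) hc₁]
    have h1 : holderTerm α f₀ j ^ 2 = θ j ^ 2 * ((j + 1 : ℕ) : ℝ) ^ (2 * α) := by
      rw [holderTerm, mul_pow, sq_abs, ← Real.rpow_natCast, ← Real.rpow_mul (by positivity)]
      rw [mul_comm]
      congr 2
      push_cast; ring
    have h2 : c₁ ≤ ((j + 1 : ℕ) : ℝ) ^ (2 * α) * m j := by
      have h3 := mul_le_mul_of_nonneg_left (hμ₁ j)
        (by positivity : 0 ≤ ((j + 1 : ℕ) : ℝ) ^ (2 * α))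
      rwa [mul_left_comm, ← Real.rpow_add (by positivity), add_neg_cancel, Real.rpow_zero,
        mul_one] at h3
    rw [h1, mul_assoc]
    gcongr
  have hsrcs : Summable fun j => θ j ^ 2 / m j :=
    Summable.of_nonneg_of_le (fun j => div_nonneg (sq_nonneg _) (hμ0 j).le) hsrc (hsq.div_const c₁)
  have hsrcle : ∑' j, θ j ^ 2 / m j ≤ R ^ 2 / c₁ := by
    refine (hsrcs.tsum_le_tsum hsrc (hsq.div_const c₁)).trans ?_
    rw [tsum_div_const]
    have : ∑' j, holderTerm α f₀ j ^ 2 ≤ R ^ 2 :=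
      hsqle.trans (pow_le_pow_left₀ hT0 hR 2)
    gcongr
  -- the normal equations
  have hG : ∀ l l', HasSum (fun j => m j * ψ j l * ψ j l') (gramMatrix K D l l') := fun l l' =>
    hK _ (hX l) _ (hX l')
  have hf : ∀ l, HasSum (fun j => θ j * ψ j l) (f₀ (D l).1) := fun l =>
    hasSum_trigCoef_mul_trigBasis hf₀ hθ0 (hX l)
  have hnorm : ∀ l, (∑ l', gramMatrix K D l l' * a l') + n * lam * a l =
      f₀ (D l).1 + ((D l).2 - f₀ (D l).1) := fun l => by
    rw [add_sub_cancel]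
    exact ridge_solution hμ0 (mul_pos hn0 hlam) hG (fun i => (D i).2) l
  obtain ⟨hUs, hU⟩ := errCoef_bound (σ := σ) (κ := κ) (c := c) (L := level n)
    (by omega : 0 < n) hlam hκ hμ0 hms0
    (fun j => (hμc j).trans (mul_le_of_le_one_right hc0.le
      (Real.rpow_le_one_of_one_le_of_nonpos (hi j) (by linarith))))
    (fun j l => abs_trigBasis_le (j + 1) (D l).1) hθ0 hsrcs.hasSum
    (fun j => by linarith [level_pos hn j]) hV hG hf hnorm hZ hA hcoer
  -- the Fourier series of the posterior mean
  set b : ℕ → ℝ := fun j => m j * ∑ l, a l * ψ j l with hb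
  have hbk : Summable fun j : ℕ => ((j + 1 : ℕ) : ℝ) ^ k * |b j| := by
    refine Summable.of_nonneg_of_le (fun j => by positivity) (fun j => ?_)
      (hms.mul_right (∑ l, |a l| * Real.sqrt 2))
    rw [hb, abs_mul, abs_of_pos (hμ0 j), mul_assoc]
    refine mul_le_mul_of_nonneg_left (mul_le_mul_of_nonneg_left ?_ (hμ0 j).le) (by positivity)
    exact (Finset.abs_sum_le_sum_abs _ _).trans (Finset.sum_le_sum fun l _ => by
      rw [abs_mul]
      exact mul_le_mul_of_nonneg_left (abs_trigBasis_le (j + 1) (D l).1) (abs_nonneg _))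
  have hpm : ∀ x ∈ Icc (0 : ℝ) 1,
      HasSum (fun j => b j * trigBasis (j + 1) x) (posteriorMean K lam D x) := by
    intro x hx
    have h1 : HasSum (fun j => ∑ l, m j * trigBasis (j + 1) x * ψ j l * a l)
        (∑ l, K x (D l).1 * a l) :=
      hasSum_sum fun l _ => (hK x hx _ (hX l)).mul_right (a l)
    refine h1.congr_fun fun j => ?_
    rw [hb]
    simp only
    rw [Finset.mul_sum, Finset.sum_mul]
    exact Finset.sum_congr rfl fun l _ => by ring
  obtain ⟨hpc, hpd⟩ := deriv01_eq_trigSeries hbk hpm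
  obtain ⟨-, hfd⟩ := deriv01_eq_trigSeries hθk
    fun x hx => hasSum_trigCoef_mul_trigBasis hf₀ hθ0 hx
  refine ⟨hpc, _, hU.trans ?_, ?_⟩
  · gcongr
  · obtain ⟨S, hS, hSle⟩ := exists_hasSum_sq_mul_pow_le (k := k) hα0 (by linarith) hlam hμ0 hμc hUs
    have hek : Summable fun j : ℕ => ((j + 1 : ℕ) : ℝ) ^ k * |errCoef ψ m θ a j| := by
      refine Summable.of_nonneg_of_le (fun j => by positivity) (fun j => ?_) (hbk.add hθk)
      rw [← mul_add]
      exact mul_le_mul_of_nonneg_left (abs_sub _ _) (by positivity)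
    have hcongr : (fun x => deriv01 k (posteriorMean K lam D) x - deriv01 k f₀ x) =ᵐ[unifLaw]
        fun x => ∑' j, errCoef ψ m θ a j * trigDeriv k (j + 1) x := by
      filter_upwards [ae_mem_Icc_unifLaw] with x hx
      have hsum : ∀ {p : ℕ → ℝ}, (Summable fun j : ℕ => ((j + 1 : ℕ) : ℝ) ^ k * |p j|) →
          Summable fun j => p j * trigDeriv k (j + 1) x := fun hp =>
        Summable.of_norm_bounded (hp.mul_left (Real.sqrt 2 * Real.pi ^ k))
          (fun j => norm_mul_trigDeriv_le _ _ _ _)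
      rw [hpd x hx, hfd x hx, ← (hsum hbk).tsum_sub (hsum hθk)]
      exact tsum_congr fun j => by rw [errCoef, sub_mul]
    rw [eLpNorm_congr_ae hcongr]
    exact (eLpNorm_trigSeries_le hek hS).trans
      (ENNReal.ofReal_le_ofReal (Real.sqrt_le_sqrt hSle))

theorem lemma5 (α : ℝ) (k : ℕ) (hα : (k : ℝ) + 1 / 2 < α) (σ : ℝ≥0) (hσ : 0 < σ)
    (R c₁ c₂ d₁ d₂ : ℝ) (hc₁ : 0 < c₁) (hd₁ : 0 < d₁) :
    ∃ C : ℝ, 0 < C ∧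
      ∀ f₀ : ℝ → ℝ, ContDiffOn ℝ k f₀ (Icc 0 1) → f₀ ∈ holderSpace α →
        ∑' j, holderTerm α f₀ j ≤ R →
      ∀ (K : ℝ → ℝ → ℝ) (μ : ℕ → ℝ), HasFourierEigenvalues K μ →
        (∀ i : ℕ, 1 ≤ i →
          c₁ * (i : ℝ) ^ (-(2 * α)) ≤ μ i ∧ μ i ≤ c₂ * (i : ℝ) ^ (-(2 * α))) →
      ∀ n : ℕ, 2 ≤ n → ∀ lam : ℝ,
        d₁ * (Real.log n / n) ^ (2 * α / (2 * α + 1)) ≤ lam →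
        lam ≤ d₂ * (Real.log n / n) ^ (2 * α / (2 * α + 1)) →
        1 - 1 / (n : ℝ) ^ 10 ≤ (dataLaw f₀ σ n).real
          {D | ContDiffOn ℝ k (posteriorMean K lam D) (Icc 0 1) ∧
            eLpNorm (fun x => deriv01 k (posteriorMean K lam D) x - deriv01 k f₀ x) 2 unifLaw ≤
              ENNReal.ofReal (C * (Real.log n / n) ^ ((α - k) / (2 * α + 1)))} := by
  have hk0 : (0 : ℝ) ≤ k := by positivity
  have hα0 : 0 < α := by linarith
  have hα2 : 1 / 2 < α := by linarith
  -- The constants must be chosen before any kernel is given, so positivity of `c₂` is not available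
  -- here; the maximum supplies it.
  set c : ℝ := max c₂ 1 with hc
  have hc0 : 0 < c := lt_of_lt_of_le one_pos (le_max_right _ _)
  obtain ⟨CV, hCV, hV⟩ := exists_tsum_weight_mul_level_le hα2 (c / d₁)
  obtain ⟨κ, hκ, hcoer⟩ := exists_coercivity_const (C := CV) hα2 hc0 hd₁
  set A : ℝ := 2 * (4 * (σ : ℝ) ^ 2 * CV + |d₂| * (R ^ 2 / c₁)) / κ ^ 2 with hA
  have hσ0 : (0 : ℝ) < σ := hσ
  have hA0 : 0 < A := by
    have : 0 < 4 * (σ : ℝ) ^ 2 * CV := by positivity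
    have : 0 ≤ |d₂| * (R ^ 2 / c₁) := by positivity
    positivity
  set B : ℝ := 2 * Real.pi ^ (2 * k) * (c / d₁) ^ (k / α) * A with hB
  have hB0 : 0 < B := by positivity
  refine ⟨Real.sqrt B, Real.sqrt_pos.2 hB0, fun f₀ hf₀ hfH hR K μ hK hμ n hn lam hlam₁ hlam₂ => ?_⟩
  change d₁ * rate α n ≤ lam at hlam₁
  change lam ≤ d₂ * rate α n at hlam₂
  have hrate := rate_pos (α := α) hn
  have hn0 : (0 : ℝ) < n := by positivity
  have hlam : 0 < lam := lt_of_lt_of_le (by positivity) hlam₁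
  have hμ₁ : ∀ j : ℕ, c₁ * ((j + 1 : ℕ) : ℝ) ^ (-(2 * α)) ≤ μ (j + 1) := fun j =>
    (hμ (j + 1) (by omega)).1
  have hμc : ∀ j : ℕ, μ (j + 1) ≤ c * ((j + 1 : ℕ) : ℝ) ^ (-(2 * α)) := fun j =>
    (hμ (j + 1) (by omega)).2.trans (by gcongr; exact le_max_left _ _)
  have hμ0 : ∀ j, 0 < μ (j + 1) := fun j => lt_of_lt_of_le (by positivity) (hμ₁ j)
  have hw := hV n hn (fun j => μ (j + 1) / (μ (j + 1) + lam))
    (fun j => div_nonneg (hμ0 j).le (by linarith [hμ0 j]))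
    (fun j => div_le_one_of_le₀ (by linarith) (by linarith [hμ0 j]))
    (fun j => by
      rw [Real.div_rpow (by have := one_le_effDim hα0 hn; linarith) (by positivity),
        effDim_rpow hα0 hn]
      calc μ (j + 1) / (μ (j + 1) + lam) ≤ μ (j + 1) / (d₁ * rate α n) := by
            have := hμ0 j
            gcongr
            linarith
        _ ≤ c * ((j + 1 : ℕ) : ℝ) ^ (-(2 * α)) / (d₁ * rate α n) := by gcongr; exact hμc j
        _ = _ := by rw [Real.rpow_neg (by positivity)]; field_simp)
  obtain ⟨hVs, hVle⟩ := hw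
  have hcontf := hf₀.continuousOn
  -- Outside `[0,1]` the function `f₀` is arbitrary, possibly non-measurable; this modification
  -- leaves the data law unchanged.
  set g : ℝ → ℝ := (Icc (0 : ℝ) 1).piecewise f₀ 0 with hg
  have hgm : Measurable g :=
    hcontf.measurable_piecewise continuousOn_const measurableSet_Icc
  have hfg : EqOn f₀ g (Icc 0 1) := fun x hx => by rw [hg, piecewise_eq_of_mem _ _ _ hx]
  obtain ⟨E, hE, hEp⟩ := exists_good_event hgm hσ hn
  have hP := isProbabilityMeasure_obsLaw (σ := σ) hgm
  have hlaw : dataLaw f₀ σ n = dataLaw g σ n := by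
    rw [dataLaw, dataLaw, obsLaw_congr hfg]
  have hPP : IsProbabilityMeasure (dataLaw g σ n) := by rw [dataLaw]; infer_instance
  rw [hlaw]
  refine hE.trans (measureReal_mono fun D hD => ?_)
  obtain ⟨hX, hZ, hAcov⟩ := hEp D hD
  obtain ⟨hcd, U, hU, hnorm⟩ := posteriorMean_error_bound (σ := (σ : ℝ)) hα hcontf hfH.2 hR hc₁ hK
    hμ₁ hμc hn hlam hκ.le hVs.hasSum (hcoer n hn lam _ hlam₁ hVle) hX
    (fun j => by simpa only [hfg (hX _)] using hZ j) hAcov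
  refine ⟨hcd, hnorm.trans (ENNReal.ofReal_le_ofReal ?_)⟩
  have hL := log_div_pos hn
  have hUle : U ≤ A * rate α n := by
    rw [hA, div_mul_eq_mul_div, le_div_iff₀ (by positivity), mul_comm]
    refine hU.trans ?_
    rw [mul_assoc 2 _ (rate α n)]
    refine mul_le_mul_of_nonneg_left ?_ zero_le_two
    rw [add_mul]
    refine add_le_add ?_ ?_
    · rw [← effDim_mul_log_div hα0 hn]
      calc 4 * (σ : ℝ) ^ 2 * (∑' j, μ (j + 1) / (μ (j + 1) + lam) * level n j) / n
          ≤ 4 * (σ : ℝ) ^ 2 * (CV * (effDim α n * Real.log n)) / n := by gcongr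
        _ = _ := by ring
    · have h1 : lam ≤ |d₂| * rate α n := hlam₂.trans (by gcongr; exact le_abs_self _)
      calc lam * (R ^ 2 / c₁) ≤ |d₂| * rate α n * (R ^ 2 / c₁) := by gcongr
        _ = _ := by ring
  have hlamp : (c / lam) ^ (k / α) ≤ (c / d₁) ^ (k / α) * (rate α n)⁻¹ ^ ((k : ℝ) / α) := by
    rw [← Real.mul_rpow (by positivity) (by positivity)]
    refine Real.rpow_le_rpow (by positivity) ?_ (by positivity)
    rw [← div_eq_mul_inv, div_div]
    gcongr
  have hfinal : 2 * Real.pi ^ (2 * k) * (c / lam) ^ (k / α) * U ≤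
      B * ((Real.log n / n) ^ ((α - k) / (2 * α + 1))) ^ 2 := by
    rw [← rate_rpow_eq hα0 hn]
    calc 2 * Real.pi ^ (2 * k) * (c / lam) ^ (k / α) * U
        ≤ 2 * Real.pi ^ (2 * k) * (c / lam) ^ (k / α) * (A * rate α n) := by gcongr
      _ ≤ 2 * Real.pi ^ (2 * k) * ((c / d₁) ^ (k / α) * (rate α n)⁻¹ ^ ((k : ℝ) / α)) *
          (A * rate α n) := by gcongr
      _ = _ := by rw [hB]; ring
  calc _ ≤ Real.sqrt (B * ((Real.log n / n) ^ ((α - k) / (2 * α + 1))) ^ 2) :=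
        Real.sqrt_le_sqrt hfinal
    _ = _ := by rw [Real.sqrt_mul hB0.le, Real.sqrt_sq (by positivity)]
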